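/- Let $G$ be a connected complex Banach--Lie group with Lie algebra $\mathfrak g$, and let $P \subseteq G$ be a connected complex Lie subgroup with Lie algebra $\mathfrak p$ (that is, a subgroup carrying a connected complex Banach--Lie group structure for which the inclusion $P \to G$ is holomorphic). Let $(\pi,V)$ be a representation of $G$ and $(\rho,E)$ a representation of $P$, by continuous linear operators on complex locally convex Hausdorff spaces, both with holomorphic orbit maps. Then $\mathfrak g$ acts on $V$ by $x.v = \mathrm d_{\mathbf 1}(g \mapsto \pi(g)v)(x)$, and $\mathfrak p$ acts on $E$ in the same way. Let $$\mathcal O_\rho(G,E) = \{ f : G \to E \text{ holomorphic} : f(gp) = \rho(p)^{-1} f(g) \text{ for all } g \in G,\ p \in P\},$$ with $G$ acting by $(g.f)(h) = f(g^{-1}h)$, and let $$\operatorname{Hom}_{\mathfrak p}(U(\mathfrak g),E) = \{ \alpha : U(\mathfrak g) \to E \text{ linear} : \alpha(Dx) = -x.\alpha(D) \text{ for all } D \in U(\mathfrak g),\ x \in \mathfrak p\},$$ with $\mathfrak g$ acting by $(x.\alpha)(D) = -\alpha(xD)$. The following are equivalent: 1. There is a continuous linear $P$-equivariant map $\beta :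 V \to E$ that is $G$-cyclic: if $v \in V$ and $\beta(\pi(g)v) = 0$ for all $g \in G$, then $v = 0$. 2. There is an injective $G$-equivariant linear map $V \to \mathcal O_\rho(G,E)$ that is continuous with respect to the topology of pointwise convergence on $\mathcal O_\rho(G,E)$. 3. There is an injective $\mathfrak g$-equivariant linear map $J : V \to \operatorname{Hom}_{\mathfrak p}(U(\mathfrak g),E)$ such that the map $V \to E$, $v \mapsto J(v)(\mathbf 1)$, is continuous. -/

import Mathlib

open scoped Manifold ContDiff Topology

set_option linter.unusedSectionVars false

noncomputable section

namespace HolInd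

/-- A map from a complex Banach manifold `N` (modelled on `X`) to a complex locally convex space
`E` is holomorphic if it is complex (Fréchet) differentiable in the charts of `N`. -/
def IsHolomorphic (X : Type*) [NormedAddCommGroup X] [NormedSpace ℂ X]
    {N : Type*} [TopologicalSpace N] [ChartedSpace X N]
    {E : Type*} [AddCommGroup E] [Module ℂ E] [TopologicalSpace E] (f : N → E) : Prop :=
  ∀ a : N, DifferentiableOn ℂ (f ∘ (chartAt X a).symm) (chartAt X a).target

section Calculus

variable {X : Type*} [NormedAddCommGroup X] [NormedSpace ℂ X]
  {N : Type*} [TopologicalSpace N] [ChartedSpace X N]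
  {E : Type*} [AddCommGroup E] [Module ℂ E] [TopologicalSpace E]
  [IsTopologicalAddGroup E] [ContinuousSMul ℂ E]

theorem hasFDerivWithinAt_add {f g : X → E} {f' g' : X →L[ℂ] E} {s : Set X} {x : X}
    (hf : HasFDerivWithinAt f f' s x) (hg : HasFDerivWithinAt g g' s x) :
    HasFDerivWithinAt (f + g) (f' + g') s x := by
  rw [hasFDerivWithinAt_iff_isLittleOTVS] at *
  refine (hf.add hg).congr_left fun y => ?_
  simp only [Pi.add_apply, add_apply]
  abel

theorem hasFDerivWithinAt_smul (c : ℂ) {f : X → E} {f' : X →L[ℂ] E} {s : Set X} {x : X}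
    (hf : HasFDerivWithinAt f f' s x) : HasFDerivWithinAt (c • f) (c • f') s x := by
  rw [hasFDerivWithinAt_iff_isLittleOTVS] at *
  have h := ((c • ContinuousLinearMap.id ℂ E).isBigOTVS_fun_comp
    (l := 𝓝[s] x) (f := fun y => f y - f x - f' (y - x))).trans_isLittleOTVS hf
  refine h.congr_left fun y => ?_
  simp [smul_sub]

theorem IsHolomorphic.add {f g : N → E} (hf : IsHolomorphic X f) (hg : IsHolomorphic X g) :
    IsHolomorphic X (f + g) := fun a x hx =>
  ⟨_, hasFDerivWithinAt_add (hf a x hx).choose_spec (hg a x hx).choose_spec⟩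

theorem IsHolomorphic.smul (c : ℂ) {f : N → E} (hf : IsHolomorphic X f) :
    IsHolomorphic X (c • f) := fun a x hx =>
  ⟨_, hasFDerivWithinAt_smul c (hf a x hx).choose_spec⟩

theorem IsHolomorphic.zero : IsHolomorphic X (0 : N → E) := fun _ x _ =>
  (differentiableAt_const (0 : E) (x := x)).differentiableWithinAt

end Calculus

/-- The derivative at the identity, in the direction of the element `x` of the Lie algebra, of a
map from a complex Lie group to a locally convex space. The Lie algebra is the tangent space at
`1`, which is identified with the model space by means of the preferred chart at `1`. -/
def derivOne {X : Type*} [NormedAddCommGroup X] [NormedSpace ℂ X]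
    {G : Type*} [TopologicalSpace G] [ChartedSpace X G] [Group G]
    {E : Type*} [AddCommGroup E] [Module ℂ E] [TopologicalSpace E]
    (f : G → E) (x : GroupLieAlgebra 𝓘(ℂ, X) G) : E :=
  fderiv ℂ (f ∘ (chartAt X (1 : G)).symm) (chartAt X (1 : G) 1) x

section Representations

variable {X : Type*} [NormedAddCommGroup X] [NormedSpace ℂ X]
  {G : Type*} [TopologicalSpace G] [ChartedSpace X G] [Group G]
  {E : Type*} [AddCommGroup E] [Module ℂ E] [TopologicalSpace E]
  [IsTopologicalAddGroup E] [ContinuousSMul ℂ E]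

theorem hasFDerivAt_of_isHolomorphic {f : G → E} (hf : IsHolomorphic X f) :
    HasFDerivAt (f ∘ (chartAt X (1 : G)).symm)
      (fderiv ℂ (f ∘ (chartAt X (1 : G)).symm) (chartAt X (1 : G) 1)) (chartAt X (1 : G) 1) := by
  have h1 := mem_chart_target X (1 : G)
  exact ((hf 1 _ h1).differentiableAt ((chartAt X (1 : G)).open_target.mem_nhds h1)).hasFDerivAt

theorem derivOne_add [T2Space E] {f g : G → E} (hf : IsHolomorphic X f) (hg : IsHolomorphic X g)
    (x : GroupLieAlgebra 𝓘(ℂ, X) G) :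
    derivOne (X := X) (f + g) x = derivOne (X := X) f x + derivOne (X := X) g x := by
  have h := hasFDerivWithinAt_add (hasFDerivAt_of_isHolomorphic hf).hasFDerivWithinAt
    (hasFDerivAt_of_isHolomorphic hg).hasFDerivWithinAt (s := Set.univ)
  rw [hasFDerivWithinAt_univ] at h
  exact DFunLike.congr_fun ((hasFDerivAt_of_isHolomorphic (hf.add hg)).unique h) x

theorem derivOne_smul [T2Space E] (c : ℂ) {f : G → E} (hf : IsHolomorphic X f)
    (x : GroupLieAlgebra 𝓘(ℂ, X) G) :
    derivOne (X := X) (c • f) x = c • derivOne (X := X) f x := by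
  have h := hasFDerivWithinAt_smul c
    (hasFDerivAt_of_isHolomorphic hf).hasFDerivWithinAt (s := Set.univ)
  rw [hasFDerivWithinAt_univ] at h
  exact DFunLike.congr_fun ((hasFDerivAt_of_isHolomorphic (hf.smul c)).unique h) x

/-- The representation `π` of the complex Lie group `G`, by continuous linear operators, has
holomorphic orbit maps. -/
def HasHolomorphicOrbits (X : Type*) [NormedAddCommGroup X] [NormedSpace ℂ X]
    {G : Type*} [TopologicalSpace G] [ChartedSpace X G] [Group G]
    {E : Type*} [AddCommGroup E] [Module ℂ E] [TopologicalSpace E]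
    (π : G →* (E →L[ℂ] E)) : Prop :=
  ∀ v : E, IsHolomorphic X (fun g : G => π g v)

/-- The derived action: `x.v` is the derivative at `1` of the orbit map of `v` in the
direction `x`. -/
def derivedRep [T2Space E] (π : G →* (E →L[ℂ] E)) (hπ : HasHolomorphicOrbits X π)
    (x : GroupLieAlgebra 𝓘(ℂ, X) G) : E →ₗ[ℂ] E where
  toFun v := derivOne (X := X) (fun g : G => π g v) x
  map_add' v w := by
    rw [← derivOne_add (hπ v) (hπ w)]
    congr 1
    ext g
    simp
  map_smul' c v := by
    rw [RingHom.id_apply, ← derivOne_smul c (hπ v)]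
    congr 1
    ext g
    simp

end Representations

section Induction

variable {X : Type*} [NormedAddCommGroup X] [NormedSpace ℂ X] [CompleteSpace X]
  {G : Type*} [TopologicalSpace G] [ChartedSpace X G] [Group G]
  {Y : Type*} [NormedAddCommGroup Y] [NormedSpace ℂ Y]
  {P : Type*} [TopologicalSpace P] [ChartedSpace Y P] [Group P]
  {E : Type*} [AddCommGroup E] [Module ℂ E] [TopologicalSpace E]
  [IsTopologicalAddGroup E] [ContinuousSMul ℂ E]

/-- The space `O_ρ(G, E)` of holomorphic maps `f : G → E` with `f (g p) = ρ(p)⁻¹ f(g)`, for a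
subgroup `incl : P → G` and a representation `ρ` of `P` on `E`. -/
def inducedSpace (X : Type*) [NormedAddCommGroup X] [NormedSpace ℂ X]
    {G : Type*} [TopologicalSpace G] [ChartedSpace X G] [Group G]
    {P : Type*} [Group P]
    {E : Type*} [AddCommGroup E] [Module ℂ E] [TopologicalSpace E]
    [IsTopologicalAddGroup E] [ContinuousSMul ℂ E]
    (incl : P →* G) (ρ : P →* (E →L[ℂ] E)) : Submodule ℂ (G → E) where
  carrier := {f | IsHolomorphic X f ∧ ∀ (g : G) (p : P), f (g * incl p) = ρ p⁻¹ (f g)}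
  add_mem' := fun hf hg => ⟨hf.1.add hg.1, fun g p => by simp [hf.2 g p, hg.2 g p]⟩
  zero_mem' := ⟨IsHolomorphic.zero, fun g p => by simp⟩
  smul_mem' := fun c _ hf => ⟨hf.1.smul c, fun g p => by simp [hf.2 g p]⟩

/-- The map of Lie algebras `L(P) → L(G)` that is tangent to a homomorphism `P → G`. -/
def lieMap (incl : P →* G) (x : GroupLieAlgebra 𝓘(ℂ, Y) P) : GroupLieAlgebra 𝓘(ℂ, X) G :=
  (mfderiv 𝓘(ℂ, Y) 𝓘(ℂ, X) incl 1 x : TangentSpace 𝓘(ℂ, X) (incl 1))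

/-- The coinduced space `Hom_𝔭(U(𝔤), E)`: the linear maps `α : U(𝔤) → E` with
`α (D x) = - x.α(D)` for all `D ∈ U(𝔤)` and `x ∈ 𝔭`. -/
def coinducedSpace [LieGroup 𝓘(ℂ, X) ω G] [T2Space E]
    (incl : P →* G) (ρ : P →* (E →L[ℂ] E)) (hρ : HasHolomorphicOrbits Y ρ) :
    Submodule ℂ (UniversalEnvelopingAlgebra ℂ (GroupLieAlgebra 𝓘(ℂ, X) G) →ₗ[ℂ] E) where
  carrier := {α | ∀ (D : UniversalEnvelopingAlgebra ℂ (GroupLieAlgebra 𝓘(ℂ, X) G))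
    (x : GroupLieAlgebra 𝓘(ℂ, Y) P),
      α (D * UniversalEnvelopingAlgebra.ι ℂ (lieMap (X := X) incl x)) =
        - derivedRep ρ hρ x (α D)}
  add_mem' := fun {a b} ha hb D x => by
    rw [LinearMap.add_apply, ha D x, hb D x, LinearMap.add_apply, map_add, neg_add]
  zero_mem' := fun D x => by simp
  smul_mem' := fun c a ha D x => by
    rw [LinearMap.smul_apply, ha D x, LinearMap.smul_apply, map_smul, smul_neg]

end Induction

end HolInd

end

/-! This is Frobenius reciprocity on two levels. Evaluating `B` or `J` at the identity gives `β`.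
Conversely, `β` yields the functions h ↦ β(π(h)⁻¹v) and the linear maps D ↦ β(Dᵗ.v), where ᵗ is the
principal antiautomorphism of U(𝔤). Between (1) and (2) this is formal, and cyclicity of `β` is
exactly injectivity of `B`.

Passing to (3) needs two analytic facts. First, the derived action must respect brackets, so that
U(𝔤) acts on V. Hahn–Banach reduces this to scalar coefficients g ↦ l(π(g)v), for which
`derivOne_lie` compares iterated right-derivatives with the bracket of left-invariant fields in a
chart. Second, infinitesimal data at 1 must determine a function on a connected group:
`eq_zero_of_forall_derivOne_mem`. Applied to g ↦ l(β(π(g)D.v)) it gives injectivity of `J`; applied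
to p ↦ l(β(π(p)w)) - l(ρ(p)β(w)) it turns 𝔭-equivariance into P-equivariance.

The identity theorem uses no exponential map. Along an analytic curve c with c(0) = 1, the
derivative of F ∘ c is a right-derivative of F in the varying direction given by the logarithmic
derivative of c; an induction on the order of vanishing shows that F ∘ c is flat at 0, and
connectedness does the rest. -/

noncomputable section

namespace HolInd

/-! ### Chain rules for holomorphic maps into topological vector spaces. -/

section Calculus

variable {X : Type*} [NormedAddCommGroup X] [NormedSpace ℂ X]
  {Z : Type*} [NormedAddCommGroup Z] [NormedSpace ℂ Z]
  {N : Type*} [TopologicalSpace N] [ChartedSpace X N]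
  {N' : Type*} [TopologicalSpace N'] [ChartedSpace Z N']
  {E : Type*} [AddCommGroup E] [Module ℂ E] [TopologicalSpace E]
  [IsTopologicalAddGroup E] [ContinuousSMul ℂ E]
  {F : Type*} [AddCommGroup F] [Module ℂ F] [TopologicalSpace F]

/-- The chain rule for a map into a topological vector space after a map of normed spaces. -/
theorem hasFDerivAt_comp {f : X → E} {f' : X →L[ℂ] E} {g : Z → X} {g' : Z →L[ℂ] X} {z : Z}
    (hf : HasFDerivAt f f' (g z)) (hg : HasFDerivAt g g' z) :
    HasFDerivAt (f ∘ g) (f'.comp g') z := by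
  rw [hasFDerivAt_iff_isLittleOTVS] at hf ⊢
  have h1 := (hf.comp_tendsto hg.continuousAt.tendsto).trans_isBigOTVS
    (Asymptotics.isBigOTVS_iff_isBigO.2 hg.isBigO_sub)
  have h2 := (f'.isBigOTVS_fun_comp (l := 𝓝 z)
    (f := fun y => g y - g z - g' (y - z))).trans_isLittleOTVS hg.isLittleOTVS
  refine (h1.add h2).congr_left fun y => ?_
  simp [map_sub]

theorem _root_.ContinuousLinearMap.hasFDerivAt_comp_of_hasFDerivAt (L : E →L[ℂ] F)
    {f : X → E} {f' : X →L[ℂ] E} {x : X} (hf : HasFDerivAt f f' x) :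
    HasFDerivAt (L ∘ f) (L.comp f') x := by
  rw [hasFDerivAt_iff_isLittleOTVS] at hf ⊢
  have h := (L.isBigOTVS_fun_comp (l := 𝓝 x)
    (f := fun y => f y - f x - f' (y - x))).trans_isLittleOTVS hf
  exact h.congr_left fun y => by simp

theorem IsHolomorphic.hasFDerivAt {f : N → E} (hf : IsHolomorphic X f) (a : N) {u : X}
    (hu : u ∈ (chartAt X a).target) :
    HasFDerivAt (f ∘ (chartAt X a).symm) (fderiv ℂ (f ∘ (chartAt X a).symm) u) u :=
  ((hf a u hu).differentiableAt ((chartAt X a).open_target.mem_nhds hu)).hasFDerivAt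

/-- The chain rule for a holomorphic map after a differentiable map from a normed space to a
manifold. -/
theorem IsHolomorphic.hasFDerivAt_comp {f : N → E} (hf : IsHolomorphic X f) {c : Z → N} {z : Z}
    (hc : MDifferentiableAt 𝓘(ℂ, Z) 𝓘(ℂ, X) c z) :
    HasFDerivAt (f ∘ c) ((fderiv ℂ (f ∘ (chartAt X (c z)).symm) (chartAt X (c z) (c z))).comp
      (fderiv ℂ (chartAt X (c z) ∘ c) z)) z := by
  have h1 : DifferentiableAt ℂ (chartAt X (c z) ∘ c) z := by
    exact (mdifferentiableAt_iff_target.1 hc).2.differentiableAt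
  have h2 := HolInd.hasFDerivAt_comp (g := chartAt X (c z) ∘ c)
    (hf.hasFDerivAt (c z) (mem_chart_target X (c z))) h1.hasFDerivAt
  refine HasFDerivAt.congr_of_eventuallyEq h2 ?_
  filter_upwards [hc.continuousAt ((chartAt X (c z)).open_source.mem_nhds
    (mem_chart_source X (c z)))] with w hw
  simp [(chartAt X (c z)).left_inv hw]

theorem mdifferentiableAt_chartAt_symm [IsManifold 𝓘(ℂ, X) 1 N] (a : N) {u : X}
    (hu : u ∈ (chartAt X a).target) :
    MDifferentiableAt 𝓘(ℂ, X) 𝓘(ℂ, X) (chartAt X a).symm u :=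
  mdifferentiableAt_atlas_symm (chart_mem_atlas X a) hu

theorem IsHolomorphic.comp [IsManifold 𝓘(ℂ, Z) 1 N'] {f : N → E} (hf : IsHolomorphic X f)
    {φ : N' → N} (hφ : MDifferentiable 𝓘(ℂ, Z) 𝓘(ℂ, X) φ) : IsHolomorphic Z (f ∘ φ) := by
  intro a u hu
  have h : MDifferentiableAt 𝓘(ℂ, Z) 𝓘(ℂ, X) (φ ∘ (chartAt Z a).symm) u :=
    (hφ _).comp u (mdifferentiableAt_chartAt_symm a hu)
  exact ⟨_, (hf.hasFDerivAt_comp h).hasFDerivWithinAt⟩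

theorem IsHolomorphic.clm_comp (L : E →L[ℂ] F) {f : N → E} (hf : IsHolomorphic X f) :
    IsHolomorphic X (L ∘ f) := fun a _ hu =>
  ⟨_, (L.hasFDerivAt_comp_of_hasFDerivAt (hf.hasFDerivAt a hu)).hasFDerivWithinAt⟩

theorem IsHolomorphic.mdifferentiable [IsManifold 𝓘(ℂ, X) 1 N] {f : N → ℂ}
    (hf : IsHolomorphic X f) : MDifferentiable 𝓘(ℂ, X) 𝓘(ℂ, ℂ) f := by
  intro a
  have h := (hf.hasFDerivAt a (mem_chart_target X a)).differentiableAt.mdifferentiableAt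
  refine (h.comp a (mdifferentiableAt_atlas (chart_mem_atlas X a)
    (mem_chart_source X a))).congr_of_eventuallyEq ?_
  filter_upwards [(chartAt X a).open_source.mem_nhds (mem_chart_source X a)] with w hw
  simp [(chartAt X a).left_inv hw]

end Calculus

/-! ### Derivatives at the identity under linear maps, curves and homomorphisms. -/

section DerivOne

variable {X : Type*} [NormedAddCommGroup X] [NormedSpace ℂ X]
  {G : Type*} [TopologicalSpace G] [ChartedSpace X G] [Group G]
  {Y : Type*} [NormedAddCommGroup Y] [NormedSpace ℂ Y]
  {P : Type*} [TopologicalSpace P] [ChartedSpace Y P] [Group P]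
  {E : Type*} [AddCommGroup E] [Module ℂ E] [TopologicalSpace E]
  [IsTopologicalAddGroup E] [ContinuousSMul ℂ E] [T2Space E]
  {F : Type*} [AddCommGroup F] [Module ℂ F] [TopologicalSpace F]
  [IsTopologicalAddGroup F] [ContinuousSMul ℂ F] [T2Space F]

theorem derivOne_clm_comp (L : E →L[ℂ] F) {f : G → E} (hf : IsHolomorphic X f)
    (x : GroupLieAlgebra 𝓘(ℂ, X) G) :
    derivOne (X := X) (L ∘ f) x = L (derivOne (X := X) f x) :=
  DFunLike.congr_fun ((hasFDerivAt_of_isHolomorphic (hf.clm_comp L)).unique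
    (L.hasFDerivAt_comp_of_hasFDerivAt (hasFDerivAt_of_isHolomorphic hf))) x

/-- The chain rule for `derivOne` along a map from a normed space. -/
theorem IsHolomorphic.fderiv_comp_eq_derivOne {f : G → E} (hf : IsHolomorphic X f) {c : Y → G}
    {z : Y} (hc : MDifferentiableAt 𝓘(ℂ, Y) 𝓘(ℂ, X) c z) (h1 : c z = 1) (y : Y) :
    fderiv ℂ (f ∘ c) z y = derivOne (X := X) f (fderiv ℂ (chartAt X (1 : G) ∘ c) z y) := by
  have h := hf.hasFDerivAt_comp hc
  rw [h1] at h
  exact DFunLike.congr_fun (h.differentiableAt.hasFDerivAt.unique h) y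

theorem derivOne_comp_hom [IsManifold 𝓘(ℂ, Y) 1 P] {f : G → E} (hf : IsHolomorphic X f)
    (φ : P →* G) (hφ : MDifferentiable 𝓘(ℂ, Y) 𝓘(ℂ, X) φ) (y : GroupLieAlgebra 𝓘(ℂ, Y) P) :
    derivOne (X := Y) (f ∘ φ) y = derivOne (X := X) f (lieMap (X := X) φ y) := by
  have h1 : (φ ∘ (chartAt Y (1 : P)).symm) (chartAt Y (1 : P) 1) = 1 := by simp
  have hc : MDifferentiableAt 𝓘(ℂ, Y) 𝓘(ℂ, X) (φ ∘ (chartAt Y (1 : P)).symm)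
      (chartAt Y (1 : P) 1) :=
    (hφ _).comp _ (mdifferentiableAt_chartAt_symm 1 (mem_chart_target Y 1))
  have h := hf.fderiv_comp_eq_derivOne hc h1 y
  have h2 : mfderiv 𝓘(ℂ, Y) 𝓘(ℂ, X) φ 1 =
      fderiv ℂ (chartAt X (φ 1) ∘ φ ∘ (chartAt Y (1 : P)).symm) (chartAt Y (1 : P) 1) := by
    have h3 : Set.range 𝓘(ℂ, Y) = Set.univ := 𝓘(ℂ, Y).range_eq_univ
    refine (hφ 1).mfderiv.trans ?_
    rw [h3, fderivWithin_univ]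
    rfl
  -- This turns the chart at `φ 1`, used by `mfderiv`, into the chart at `1`, used by `derivOne`.
  rw [map_one] at h2
  exact h.trans (congrArg _ (DFunLike.congr_fun h2 y).symm)

end DerivOne

/-! ### Second derivatives and Lie brackets on open subsets of a normed space. -/

section Banach

open Metric Filter

variable {X : Type*} [NormedAddCommGroup X] [NormedSpace ℂ X] {U : Set X} {f : X → ℂ} {a : X}

/-- Cauchy's estimate: the derivative of a holomorphic function on an open subset of a normed space
is locally Lipschitz. -/
theorem exists_lipschitz_fderiv (hU : IsOpen U) (hf : DifferentiableOn ℂ f U) (ha : a ∈ U) :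
    ∃ r > 0, ∃ C ≥ 0, ball a r ⊆ U ∧
      ∀ u ∈ ball a r, ∀ w ∈ ball a r, ‖fderiv ℂ f u - fderiv ℂ f w‖ ≤ C * ‖u - w‖ := by
  obtain ⟨R, hR, hRU⟩ := Metric.isOpen_iff.1 hU a ha
  obtain ⟨R', hR', hR'f⟩ := Metric.continuousAt_iff.1
    (hf.continuousOn.continuousAt (hU.mem_nhds ha)) 1 one_pos
  -- With 4r available, balls of radius 2r about points of B(a, 2r) remain where f oscillates by
  -- less than 2, so Cauchy bounds the derivative by 2 / (2r).
  obtain ⟨r, hr, hrR, hrR'⟩ : ∃ r > 0, 4 * r ≤ R ∧ 4 * r ≤ R' :=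
    ⟨min R R' / 4, by positivity, by linarith [min_le_left R R'], by linarith [min_le_right R R']⟩
  have hball : ∀ u ∈ ball a (4 * r), u ∈ U ∧ dist (f u) (f a) < 1 := fun u hu =>
    ⟨hRU (ball_subset_ball hrR hu), hR'f (ball_subset_ball hrR' hu)⟩
  have hdiff : ∀ u ∈ ball a (4 * r), DifferentiableAt ℂ f u := fun u hu =>
    hf.differentiableAt (hU.mem_nhds (hball u hu).1)
  have hsub : ∀ u ∈ ball a (2 * r), ball u (2 * r) ⊆ ball a (4 * r) := fun u hu =>
    ball_subset_ball' (by rw [mem_ball] at hu; linarith)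
  have h1 : ∀ u ∈ ball a (2 * r), ‖fderiv ℂ f u‖ ≤ 1 / r := by
    intro u hu
    have := Complex.norm_fderiv_le_div_of_mapsTo_ball (f := f) (c := u) (R₁ := 2 * r) (R₂ := 2)
      (fun v hv => (hdiff v (hsub u hu hv)).differentiableWithinAt) (fun v hv => ?_) (by positivity)
    · convert this using 1
      field_simp
    · have e1 := (hball v (hsub u hu hv)).2
      have e2 := (hball u (hsub u hu (mem_ball_self (by positivity)))).2
      rw [mem_closedBall]
      linarith [dist_triangle_right (f v) (f u) (f a)]
  have h2 : ∀ u ∈ ball a (2 * r), ∀ w ∈ ball a (2 * r), ‖f u - f w‖ ≤ 1 / r * ‖u - w‖ :=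
    fun u hu w hw => (convex_ball a (2 * r)).norm_image_sub_le_of_norm_fderiv_le
      (fun v hv => hdiff v (ball_subset_ball (by linarith) hv)) h1 hw hu
  refine ⟨r, hr, 2 / r ^ 2, by positivity,
    fun u hu => (hball u (ball_subset_ball (by linarith) hu)).1, fun u hu w hw => ?_⟩
  have hadd : ∀ v ∈ ball a r, ∀ y ∈ ball (0 : X) r, v + y ∈ ball a (2 * r) := by
    intro v hv y hy
    rw [mem_ball, dist_eq_norm] at *
    calc ‖v + y - a‖ = ‖(v - a) + (y - 0)‖ := by congr 1; abel
      _ ≤ ‖v - a‖ + ‖y - 0‖ := norm_add_le _ _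
      _ < 2 * r := by linarith
  have hd : ∀ v ∈ ball a r, ∀ y ∈ ball (0 : X) r,
      HasFDerivAt (fun y => f (v + y)) (fderiv ℂ f (v + y)) y := by
    intro v hv y hy
    have := (hdiff _ (ball_subset_ball (by linarith) (hadd v hv y hy))).hasFDerivAt
    exact (hasFDerivAt_comp_add_left v).2 this
  have h3 : ∀ y ∈ ball (0 : X) r, ‖f (u + y) - f (w + y)‖ ≤ 1 / r * ‖u - w‖ := fun y hy => by
    simpa using h2 _ (hadd u hu y hy) _ (hadd w hw y hy)
  have h0 : (0 : X) ∈ ball (0 : X) r := mem_ball_self hr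
  -- A second Cauchy estimate, now for the difference of two translates, which is small because f is
  -- Lipschitz.
  have := Complex.norm_fderiv_le_div_of_mapsTo_ball (f := fun y => f (u + y) - f (w + y))
    (c := 0) (R₁ := r) (R₂ := 2 * (1 / r * ‖u - w‖))
    (fun y hy => ((hd u hu y hy).sub (hd w hw y hy)).differentiableAt.differentiableWithinAt)
    (fun y hy => ?_) hr
  · have hd0 : HasFDerivAt (fun y => f (u + y) - f (w + y)) _ 0 := (hd u hu 0 h0).sub (hd w hw 0 h0)
    rw [hd0.fderiv, add_zero, add_zero] at this
    refine this.trans_eq ?_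
    field_simp
  · rw [mem_closedBall, dist_eq_norm]
    linarith [norm_sub_le (f (u + y) - f (w + y)) (f (u + 0) - f (w + 0)), h3 y hy, h3 0 h0]

theorem eventually_line_mem {S : Set X} (hS : S ∈ 𝓝 a) (x : X) :
    ∃ δ > 0, ∀ ζ ∈ ball (0 : ℂ) δ, a + ζ • x ∈ S := by
  have : Tendsto (fun ζ : ℂ => a + ζ • x) (𝓝 0) (𝓝 a) :=
    Continuous.tendsto' (by fun_prop) _ _ (by simp)
  exact Metric.eventually_nhds_iff_ball.1 (this hS)

theorem hasDerivAt_line (a x : X) (ζ : ℂ) : HasDerivAt (fun ζ : ℂ => a + ζ • x) x ζ := by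
  simpa using ((hasDerivAt_id ζ).smul_const x).const_add a

/-- The mixed second directional derivatives of a holomorphic function exist and are symmetric. -/
theorem exists_hasDerivAt_fderiv_line (hU : IsOpen U) (hf : DifferentiableOn ℂ f U) (ha : a ∈ U)
    (x y : X) : ∃ d : ℂ, HasDerivAt (fun ζ : ℂ => fderiv ℂ f (a + ζ • x) y) d 0 ∧
      HasDerivAt (fun ζ : ℂ => fderiv ℂ f (a + ζ • y) x) d 0 := by
  obtain ⟨r, hr, C, hC, hrU, hL⟩ := exists_lipschitz_fderiv hU hf ha
  have hdiff : ∀ u ∈ ball a r, DifferentiableAt ℂ f u := fun u hu =>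
    hf.differentiableAt (hU.mem_nhds (hrU hu))
  -- Mean value inequality on the ball intersected with the closed ball of radius ‖h‖ about u, where
  -- the derivative differs from that at u by at most C‖h‖.
  have hquad : ∀ u ∈ ball a r, ∀ h, u + h ∈ ball a r →
      ‖f (u + h) - f u - fderiv ℂ f u h‖ ≤ C * ‖h‖ ^ 2 := by
    intro u hu h huh
    have := ((convex_ball a r).inter (convex_closedBall u ‖h‖)).norm_image_sub_le_of_norm_fderiv_le'
      (f := f) (𝕜 := ℂ) (φ := fderiv ℂ f u) (C := C * ‖h‖) (fun v hv => hdiff v hv.1)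
      (fun v hv => (hL v hv.1 u hu).trans ?_) ⟨hu, by simp⟩ ⟨huh, by simp⟩
    · simpa [pow_two, mul_assoc] using this
    · exact mul_le_mul_of_nonneg_left (by simpa [dist_eq_norm] using hv.2) hC
  obtain ⟨δ, hδ, hδx⟩ := eventually_line_mem (ball_mem_nhds a (half_pos hr)) x
  obtain ⟨ε, hε, hεy⟩ := eventually_line_mem (ball_mem_nhds (0 : X) (half_pos hr)) y
  have hxy : ∀ ζ ∈ ball (0 : ℂ) δ, ∀ t ∈ ball (0 : ℂ) ε, a + ζ • x + t • y ∈ ball a r := by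
    intro ζ hζ t ht
    have h1 := hδx ζ hζ
    have h2 := hεy t ht
    rw [mem_ball, dist_eq_norm] at *
    calc ‖a + ζ • x + t • y - a‖ = ‖(a + ζ • x - a) + (0 + t • y - 0)‖ := by congr 1; abel
      _ ≤ ‖a + ζ • x - a‖ + ‖0 + t • y - 0‖ := norm_add_le _ _
      _ < r := by linarith
  have hx : ∀ ζ ∈ ball (0 : ℂ) δ, a + ζ • x ∈ ball a r := fun ζ hζ =>
    ball_subset_ball (by linarith) (hδx ζ hζ)
  -- Difference quotients in direction y as functions of ζ; `hquad` makes them converge uniformly as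
  -- t → 0.
  let φ : ℂ → ℂ → ℂ := fun t ζ => t⁻¹ * (f (a + ζ • x + t • y) - f (a + ζ • x))
  have hφ : ∀ t ∈ ball (0 : ℂ) ε, ∀ ζ ∈ ball (0 : ℂ) δ, HasDerivAt (φ t)
      (t⁻¹ * (fderiv ℂ f (a + ζ • x + t • y) x - fderiv ℂ f (a + ζ • x) x)) ζ := by
    intro t ht ζ hζ
    have h1 := (hdiff _ (hxy ζ hζ t ht)).hasFDerivAt.comp_hasDerivAt ζ
      ((hasDerivAt_line a x ζ).add_const (t • y))
    have h2 := (hdiff _ (hx ζ hζ)).hasFDerivAt.comp_hasDerivAt ζ (hasDerivAt_line a x ζ)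
    exact (h1.sub h2).const_mul _
  have hε' : ∀ᶠ t in 𝓝[≠] (0 : ℂ), t ∈ ball (0 : ℂ) ε :=
    eventually_nhdsWithin_of_eventually_nhds (ball_mem_nhds 0 hε)
  have hlim : TendstoLocallyUniformlyOn φ (fun ζ => fderiv ℂ f (a + ζ • x) y) (𝓝[≠] 0)
      (ball 0 δ) := by
    refine TendstoUniformlyOn.tendstoLocallyUniformlyOn ?_
    rw [Metric.tendstoUniformlyOn_iff]
    intro η hη
    have h0 : Tendsto (fun t : ℂ => C * ‖y‖ ^ 2 * ‖t‖) (𝓝[≠] 0) (𝓝 0) :=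
      (Continuous.tendsto' (by fun_prop) _ _ (by simp)).mono_left nhdsWithin_le_nhds
    filter_upwards [hε', self_mem_nhdsWithin, h0.eventually (gt_mem_nhds hη)] with t ht ht0 htη ζ hζ
    have ht0 : t ≠ 0 := ht0
    refine lt_of_le_of_lt ?_ htη
    have := hquad _ (hx ζ hζ) (t • y) (hxy ζ hζ t ht)
    rw [dist_comm, dist_eq_norm]
    calc ‖φ t ζ - fderiv ℂ f (a + ζ • x) y‖
        = ‖t⁻¹ * (f (a + ζ • x + t • y) - f (a + ζ • x) - fderiv ℂ f (a + ζ • x) (t • y))‖ := by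
          congr 1
          simp only [φ, map_smul, smul_eq_mul]
          field_simp
      _ ≤ ‖t‖⁻¹ * (C * ‖t • y‖ ^ 2) := by
          rw [norm_mul, norm_inv]
          gcongr
      _ = C * ‖y‖ ^ 2 * ‖t‖ := by
          have := norm_ne_zero_iff.2 ht0
          rw [norm_smul]
          field_simp
  have hφd : ∀ᶠ t in 𝓝[≠] (0 : ℂ), DifferentiableOn ℂ (φ t) (ball 0 δ) :=
    hε'.mono fun t ht ζ hζ => (hφ t ht ζ hζ).differentiableAt.differentiableWithinAt
  have h0 : (0 : ℂ) ∈ ball (0 : ℂ) δ := mem_ball_self hδ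
  -- Weierstrass: the limit is holomorphic in ζ and the ζ-derivatives converge to its derivative. At
  -- ζ = 0 these are the difference quotients of the other mixed derivative, whence existence and
  -- symmetry together.
  refine ⟨_, ((hlim.differentiableOn hφd isOpen_ball).differentiableAt
    (isOpen_ball.mem_nhds h0)).hasDerivAt, ?_⟩
  rw [hasDerivAt_iff_tendsto_slope]
  refine ((hlim.deriv hφd isOpen_ball).tendsto_at h0).congr' ?_
  filter_upwards [hε'] with t ht
  simp only [Function.comp_apply, (hφ t ht 0 h0).deriv, slope_def_field]
  simp [div_eq_inv_mul]

/-- A product rule: split off the terms with one factor frozen at a. The remaining product of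
increments is O(ζ²), since the derivative of f is locally Lipschitz. -/
theorem hasDerivAt_fderiv_apply_vectorField (hU : IsOpen U) (hf : DifferentiableOn ℂ f U)
    (ha : a ∈ U) {W : X → X} (hW : DifferentiableAt ℂ W a) {x : X} {d : ℂ}
    (hd : HasDerivAt (fun ζ : ℂ => fderiv ℂ f (a + ζ • x) (W a)) d 0) :
    HasDerivAt (fun ζ : ℂ => fderiv ℂ f (a + ζ • x) (W (a + ζ • x)))
      (d + fderiv ℂ f a (fderiv ℂ W a x)) 0 := by
  obtain ⟨r, hr, C, hC, hrU, hL⟩ := exists_lipschitz_fderiv hU hf ha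
  have hl : HasDerivAt (fun ζ : ℂ => a + ζ • x) x 0 := hasDerivAt_line a x 0
  have ha0 : a + (0 : ℂ) • x = a := by simp
  have hWl : HasDerivAt (fun ζ : ℂ => W (a + ζ • x)) (fderiv ℂ W a x) 0 := by
    have := hW.hasFDerivAt
    rw [← ha0] at this
    have := this.comp_hasDerivAt (0 : ℂ) hl
    rwa [ha0] at this
  have h1 : HasDerivAt (fun ζ : ℂ => fderiv ℂ f a (W (a + ζ • x) - W a))
      (fderiv ℂ f a (fderiv ℂ W a x)) 0 :=
    (fderiv ℂ f a).hasFDerivAt.comp_hasDerivAt (0 : ℂ) (hWl.sub_const (W a))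
  have h2 : HasDerivAt (fun ζ : ℂ => (fderiv ℂ f (a + ζ • x) - fderiv ℂ f a)
      (W (a + ζ • x) - W a)) 0 0 := by
    have e1 : (fun ζ : ℂ => fderiv ℂ f (a + ζ • x) - fderiv ℂ f a)
        =O[𝓝 0] (fun ζ : ℂ => ζ - 0) := by
      refine Asymptotics.IsBigO.trans (g := fun ζ : ℂ => ζ • x) ?_ ?_
      · refine Asymptotics.IsBigO.of_bound C ?_
        obtain ⟨δ, hδ, hδx⟩ := eventually_line_mem (ball_mem_nhds a hr) x
        filter_upwards [ball_mem_nhds (0 : ℂ) hδ] with ζ hζ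
        simpa using hL _ (hδx ζ hζ) a (mem_ball_self hr)
      · refine Asymptotics.IsBigO.of_bound ‖x‖ (Eventually.of_forall fun ζ => ?_)
        rw [norm_smul, sub_zero, mul_comm]
    have e2 : (fun ζ : ℂ => W (a + ζ • x) - W a) =O[𝓝 0] (fun ζ : ℂ => ζ - 0) := by
      simpa using hWl.isBigO_sub
    have e3 : (fun ζ : ℂ => (fderiv ℂ f (a + ζ • x) - fderiv ℂ f a) (W (a + ζ • x) - W a))
        =O[𝓝 0] (fun ζ : ℂ => ‖ζ - 0‖ ^ 2) := by
      refine Asymptotics.IsBigO.trans (Asymptotics.IsBigO.of_bound 1 ?_)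
        ((e1.norm_left.mul e2.norm_left).trans (g := fun ζ : ℂ => (ζ - 0) * (ζ - 0))
          (k := fun ζ : ℂ => ‖ζ - 0‖ ^ 2) ?_)
      · refine Eventually.of_forall fun ζ => ?_
        rw [one_mul, norm_mul, norm_norm, norm_norm]
        exact ContinuousLinearMap.le_opNorm _ _
      · exact Asymptotics.IsBigO.of_bound 1 (Eventually.of_forall fun ζ => by simp [pow_two])
    simpa using (e3.hasFDerivAt one_lt_two).hasDerivAt
  refine ((hd.add h1).add h2).congr_deriv (by simp) |>.congr_of_eventuallyEq ?_
  refine Eventually.of_forall fun ζ => ?_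
  simp only [Pi.add_apply, map_sub, sub_apply]
  ring

/-- The commutator of two vector fields acting on a holomorphic function is the action of their
Lie bracket. -/
theorem exists_hasDerivAt_sub_eq_lieBracket (hU : IsOpen U) (hf : DifferentiableOn ℂ f U)
    (ha : a ∈ U) {V W : X → X} (hV : DifferentiableAt ℂ V a) (hW : DifferentiableAt ℂ W a) :
    ∃ d e : ℂ, HasDerivAt (fun ζ : ℂ => fderiv ℂ f (a + ζ • V a) (W (a + ζ • V a))) d 0 ∧
      HasDerivAt (fun ζ : ℂ => fderiv ℂ f (a + ζ • W a) (V (a + ζ • W a))) e 0 ∧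
      d - e = fderiv ℂ f a (VectorField.lieBracket ℂ V W a) := by
  obtain ⟨d, h1, h2⟩ := exists_hasDerivAt_fderiv_line hU hf ha (V a) (W a)
  refine ⟨_, _, hasDerivAt_fderiv_apply_vectorField hU hf ha hW h1,
    hasDerivAt_fderiv_apply_vectorField hU hf ha hV h2, ?_⟩
  simp [VectorField.lieBracket]

end Banach

/-! ### Orders of vanishing in one variable. -/

section OneVariable

open Metric Filter Asymptotics

theorem isBigO_pow_succ_of_hasDerivAt {h h' : ℂ → ℂ} {n : ℕ}
    (hh : ∀ᶠ z in 𝓝 0, HasDerivAt h (h' z) z) (h0 : h 0 = 0)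
    (hO : h' =O[𝓝 0] fun z : ℂ => z ^ n) : h =O[𝓝 0] fun z : ℂ => z ^ (n + 1) := by
  obtain ⟨C, hC⟩ := hO.bound
  obtain ⟨δ, hδ, hball⟩ := Metric.eventually_nhds_iff_ball.1 (hh.and hC)
  refine IsBigO.of_bound C ?_
  filter_upwards [ball_mem_nhds (0 : ℂ) hδ] with z hz
  have hsub : closedBall (0 : ℂ) ‖z‖ ⊆ ball 0 δ :=
    closedBall_subset_ball (by simpa using hz)
  have hC0 : 0 ≤ C * ‖z‖ ^ n := by
    simpa using (norm_nonneg _).trans (hball z hz).2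
  have := (convex_closedBall (0 : ℂ) ‖z‖).norm_image_sub_le_of_norm_hasDerivWithin_le (f := h)
    (f' := h') (C := C * ‖z‖ ^ n) (fun w hw => (hball w (hsub hw)).1.hasDerivWithinAt)
    (fun w hw => (hball w (hsub hw)).2.trans ?_) (x := 0) (y := z) (by simp) (by simp)
  · simpa [h0, pow_succ, mul_assoc] using this
  -- C ≥ 0 is obtained by cancelling ‖z‖ ^ n, so n = 0 and z = 0 (where w = 0) are treated apart.
  · rcases n.eq_zero_or_pos with rfl | hn
    · simp
    rcases eq_or_ne z 0 with rfl | hz0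
    · have : w = 0 := by simpa using hw
      simp [this]
    · have hCn : 0 ≤ C := nonneg_of_mul_nonneg_left hC0 (pow_pos (norm_pos_iff.2 hz0) n)
      rw [norm_pow]
      gcongr
      simpa using hw

/-- Otherwise h = zⁿg near 0 with g(0) ≠ 0, and the bound by zⁿ⁺¹ forces g(0) = 0. -/
theorem eventually_eq_zero_of_forall_isBigO_pow {h : ℂ → ℂ} (hh : AnalyticAt ℂ h 0)
    (hO : ∀ n : ℕ, h =O[𝓝 0] fun z : ℂ => z ^ n) : ∀ᶠ z in 𝓝 0, h z = 0 := by
  by_contra hne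
  obtain ⟨n, g, hg, hg0, hgh⟩ := hh.exists_eventuallyEq_pow_smul_nonzero_iff.2 hne
  have h1 : g =O[𝓝[≠] 0] fun z : ℂ => z := by
    obtain ⟨C, hC⟩ := (hO (n + 1)).bound
    refine IsBigO.of_bound C ?_
    filter_upwards [eventually_nhdsWithin_of_eventually_nhds hC,
      eventually_nhdsWithin_of_eventually_nhds hgh, self_mem_nhdsWithin] with z hz hz' hz0
    have hz0 : z ≠ 0 := hz0
    rw [hz', sub_zero, norm_smul, pow_succ, norm_mul, mul_left_comm] at hz
    exact le_of_mul_le_mul_left hz (norm_pos_iff.2 (pow_ne_zero n hz0))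
  have h2 : Tendsto g (𝓝[≠] 0) (𝓝 0) :=
    h1.trans_tendsto (tendsto_id.mono_left nhdsWithin_le_nhds)
  exact hg0 (tendsto_nhds_unique (hg.continuousAt.tendsto.mono_left nhdsWithin_le_nhds) h2)

theorem analyticAt_dslope {E : Type*} [NormedAddCommGroup E] [NormedSpace ℂ E] {f : ℂ → E} {z : ℂ}
    (hf : AnalyticAt ℂ f z) : AnalyticAt ℂ (dslope f z) z :=
  let ⟨_, hp⟩ := hf
  hp.has_fpower_series_dslope_fslope.analyticAt

end OneVariable

/-! ### The identity theorem on a connected complex Lie group. -/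

section Identity

open Metric Filter Asymptotics

variable {X : Type*} [NormedAddCommGroup X] [NormedSpace ℂ X]
  {G : Type*} [TopologicalSpace G] [ChartedSpace X G] [Group G]

section

variable {E : Type*} [AddCommGroup E] [Module ℂ E] [TopologicalSpace E]

theorem derivOne_vadd (f : G → E) (x y : GroupLieAlgebra 𝓘(ℂ, X) G) :
    derivOne (X := X) f (x + y) = derivOne (X := X) f x + derivOne (X := X) f y :=
  map_add (fderiv ℂ (f ∘ (chartAt X (1 : G)).symm) (chartAt X (1 : G) 1)) x y

theorem derivOne_vsmul (f : G → E) (c : ℂ) (x : GroupLieAlgebra 𝓘(ℂ, X) G) :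
    derivOne (X := X) f (c • x) = c • derivOne (X := X) f x :=
  map_smul (fderiv ℂ (f ∘ (chartAt X (1 : G)).symm) (chartAt X (1 : G) 1)) c x

theorem derivOne_eq_add_smul (f : G → E) {w x y : X} {c : ℂ} (h : w = x + c • y) :
    derivOne (X := X) f w = derivOne (X := X) f x + c • derivOne (X := X) f y := by
  subst h
  exact (derivOne_vadd (X := X) f x _).trans (congrArg _ (derivOne_vsmul f c y))

end

variable [LieGroup 𝓘(ℂ, X) ω G]

theorem mdifferentiable_mul_left (g : G) :
    MDifferentiable 𝓘(ℂ, X) 𝓘(ℂ, X) (fun h : G => g * h) :=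
  (contMDiff_mul_left (I := 𝓘(ℂ, X)) (n := ω)).mdifferentiable (by simp)

theorem IsHolomorphic.comp_mul_left {E : Type*} [AddCommGroup E] [Module ℂ E] [TopologicalSpace E]
    [IsTopologicalAddGroup E] [ContinuousSMul ℂ E] {f : G → E} (hf : IsHolomorphic X f) (g : G) :
    IsHolomorphic X (fun h => f (g * h)) :=
  hf.comp (mdifferentiable_mul_left g)

/-- Cauchy's estimate on one chart ball serves all g near 1, because (g, h) ↦ F(gh) is continuous at
(1, 1). It starts the inner induction of `isBigO_pow_of_forall_derivOne_mem`. -/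
theorem exists_norm_derivOne_mul_left_le {F : G → ℂ} (hF : IsHolomorphic X F) :
    ∃ M : ℝ, ∀ᶠ g in 𝓝 (1 : G), ∀ x : X,
      ‖derivOne (X := X) (fun h => F (g * h)) x‖ ≤ M * ‖x‖ := by
  have := topologicalGroup_of_lieGroup 𝓘(ℂ, X) ω (G := G)
  have hcont : ContinuousAt (fun p : G × G => F (p.1 * p.2)) (1, 1) :=
    (hF.mdifferentiable.continuous.comp continuous_mul).continuousAt
  have h1 := Metric.continuousAt_iff'.1 hcont 1 one_pos
  rw [nhds_prod_eq] at h1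
  obtain ⟨p, hp, q, hq, hpq⟩ := Filter.eventually_prod_iff.1 h1
  have hs : ContinuousAt (chartAt X (1 : G)).symm (chartAt X (1 : G) 1) :=
    (chartAt X (1 : G)).continuousAt_symm (mem_chart_target X 1)
  have hq' : ∀ᶠ u in 𝓝 (chartAt X (1 : G) 1), q ((chartAt X (1 : G)).symm u) := by
    refine hs.eventually ?_
    rwa [(chartAt X (1 : G)).left_inv (mem_chart_source X 1)]
  obtain ⟨R, hR, hball⟩ := Metric.eventually_nhds_iff_ball.1
    (hq'.and ((chartAt X (1 : G)).open_target.mem_nhds (mem_chart_target X 1)))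
  refine ⟨2 / R, hp.mono fun g hg x => ?_⟩
  refine ContinuousLinearMap.le_of_opNorm_le _ ?_ _
  refine Complex.norm_fderiv_le_div_of_mapsTo_ball
    (((hF.comp_mul_left g) 1).mono fun u hu => (hball u hu).2) (fun u hu => ?_) hR
  have e1 := hpq hg (hball u hu).1
  have e2 := hpq hg (hball _ (mem_ball_self hR)).1
  rw [mem_closedBall]
  refine (dist_triangle_right _ _ (F (1 * 1))).trans ?_
  simp only [Function.comp_apply]
  linarith

variable [CompleteSpace X]

/-- The left logarithmic derivative of an analytic curve in a Lie group is analytic. -/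
theorem exists_analyticAt_logarithmicDeriv {c : ℂ → G}
    (hc : ∀ᶠ z in 𝓝 0, ContMDiffAt 𝓘(ℂ, ℂ) 𝓘(ℂ, X) ω c z) :
    ∃ l : ℂ → X, AnalyticAt ℂ l 0 ∧ ∀ᶠ z in 𝓝 0, ∀ F : G → ℂ, IsHolomorphic X F →
      HasDerivAt (F ∘ c) (derivOne (X := X) (fun h => F (c z * h)) (l z)) z := by
  -- Jointly analytic near the diagonal point (0, 0); the logarithmic derivative is its second
  -- partial derivative on the diagonal.
  let Ψ : ℂ × ℂ → X := fun p => chartAt X (1 : G) ((c p.1)⁻¹ * c p.2)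
  have hΨ : ∀ᶠ z in 𝓝 0, ContDiffAt ℂ ω Ψ (z, z) := by
    filter_upwards [hc] with z hz
    have h1 : ContMDiffAt 𝓘(ℂ, ℂ × ℂ) 𝓘(ℂ, X) ω (fun p : ℂ × ℂ => c p.1) (z, z) :=
      ContMDiffAt.comp (z, z) (g := c) (f := Prod.fst) hz contDiff_fst.contMDiff.contMDiffAt
    have h2 : ContMDiffAt 𝓘(ℂ, ℂ × ℂ) 𝓘(ℂ, X) ω (fun p : ℂ × ℂ => c p.2) (z, z) :=
      ContMDiffAt.comp (z, z) (g := c) (f := Prod.snd) hz contDiff_snd.contMDiff.contMDiffAt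
    have h3 := h1.inv.mul h2
    have h4 : ContMDiffAt 𝓘(ℂ, X) 𝓘(ℂ, X) ω (chartAt X (1 : G)) ((c z)⁻¹ * c z) :=
      contMDiffAt_of_mem_maximalAtlas (IsManifold.chart_mem_maximalAtlas 1)
        (by simp)
    exact (ContMDiffAt.comp (z, z) h4 h3).contDiffAt
  have hΨ0 : AnalyticAt ℂ Ψ (0, 0) := hΨ.self_of_nhds.analyticAt
  refine ⟨fun z => fderiv ℂ Ψ (z, z) (0, 1), ?_, ?_⟩
  · have h1 : AnalyticAt ℂ (fun z : ℂ => (z, z)) 0 := analyticAt_id.prod analyticAt_id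
    exact ((ContinuousLinearMap.apply ℂ X ((0, 1) : ℂ × ℂ)).analyticAt _).fun_comp
      (AnalyticAt.fun_comp (f := fun z : ℂ => (z, z)) hΨ0.fderiv h1)
  · filter_upwards [hc, hΨ] with z hz hΨz F hF
    have h1 : MDifferentiableAt 𝓘(ℂ, ℂ) 𝓘(ℂ, X) (fun s => (c z)⁻¹ * c s) z :=
      (mdifferentiable_mul_left (c z)⁻¹ _).comp z (hz.mdifferentiableAt (by simp))
    have h2 := (hF.comp_mul_left (c z)).fderiv_comp_eq_derivOne h1 (by simp) 1
    have h3 := (hF.comp_mul_left (c z)).hasFDerivAt_comp h1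
    have h4 : ((fun h => F (c z * h)) ∘ fun s => (c z)⁻¹ * c s) = F ∘ c := by
      ext s
      simp
    have h5 : HasDerivAt (fun s : ℂ => (z, s)) ((0, 1) : ℂ × ℂ) z :=
      (hasDerivAt_const z z).prodMk (hasDerivAt_id z)
    have h6 := (hΨz.differentiableAt (by simp)).hasFDerivAt.comp_hasDerivAt z h5
    have h7 : fderiv ℂ (chartAt X (1 : G) ∘ fun s => (c z)⁻¹ * c s) z 1 =
        fderiv ℂ Ψ (z, z) (0, 1) := by
      rw [fderiv_apply_one_eq_deriv]
      exact h6.deriv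
    rw [h4] at h2 h3
    rw [h7] at h2
    rw [← h2, fderiv_apply_one_eq_deriv]
    exact h3.differentiableAt.hasDerivAt

/-- A family of holomorphic functions, closed under right-derivatives, all of which vanish at `1`,
vanishes to infinite order along analytic curves through `1`. -/
theorem isBigO_pow_of_forall_derivOne_mem {𝓕 : Set (G → ℂ)} (hol : ∀ F ∈ 𝓕, IsHolomorphic X F)
    (hder : ∀ F ∈ 𝓕, ∀ x : GroupLieAlgebra 𝓘(ℂ, X) G,
      (fun g => derivOne (X := X) (fun h => F (g * h)) x) ∈ 𝓕)
    (hone : ∀ F ∈ 𝓕, F 1 = 0) {c : ℂ → G} (hc : ∀ᶠ z in 𝓝 0, ContMDiffAt 𝓘(ℂ, ℂ) 𝓘(ℂ, X) ω c z)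
    (hc0 : c 0 = 1) (n : ℕ) : ∀ F ∈ 𝓕, (F ∘ c) =O[𝓝 0] fun z : ℂ => z ^ n := by
  obtain ⟨l, hl, hlF⟩ := exists_analyticAt_logarithmicDeriv hc
  have hcc : ContinuousAt c 0 := hc.self_of_nhds.continuousAt
  induction n with
  | zero =>
    intro F hF
    simp only [pow_zero]
    refine Tendsto.isBigO_one ℂ (c := F (c 0)) ?_
    exact ((hol F hF).mdifferentiable.continuous.continuousAt.comp hcc).tendsto
  | succ n ih =>
    intro F hF
    -- Inner induction for a varying direction r(z) = r(0) + z · dslope: the constant part gives a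
    -- member of the family, so `ih` applies, and the factor z raises the order of the other part by
    -- one. Taking r = l bounds (F ∘ c)′ by zⁿ, and integration gains one more order.
    have key : ∀ k ≤ n, ∀ r : ℂ → X, AnalyticAt ℂ r 0 →
        (fun z => derivOne (X := X) (fun h => F (c z * h)) (r z)) =O[𝓝 0] fun z : ℂ => z ^ k := by
      intro k
      induction k with
      | zero =>
        intro _ r hr
        obtain ⟨M, hM⟩ := exists_norm_derivOne_mul_left_le (hol F hF)
        rw [← hc0] at hM
        simp only [pow_zero]
        exact (IsBigO.of_bound M ((hcc.eventually hM).mono fun z hz => hz (r z))).trans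
          (hr.continuousAt.tendsto.isBigO_one ℂ)
      | succ k ihk =>
        intro hk r hr
        have h1 := ih _ (hder F hF (r 0))
        have h2 := ihk (by omega) _ (analyticAt_dslope hr)
        have h3 : (fun z : ℂ => z ^ n) =O[𝓝 0] fun z : ℂ => z ^ (k + 1) :=
          IsBigO.of_bound 1 (by
            filter_upwards [ball_mem_nhds (0 : ℂ) one_pos] with z hz
            rw [one_mul, norm_pow, norm_pow]
            exact pow_le_pow_of_le_one (norm_nonneg z) (mem_ball_zero_iff.1 hz).le hk)
        have h4 := (h1.trans h3).add (((isBigO_refl (fun z : ℂ => z) (𝓝 0)).mul h2).congr_right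
          (g₂ := fun z => z ^ (k + 1)) fun z => by ring)
        refine h4.congr_left fun z => ?_
        have h5 : r z = r 0 + z • dslope r 0 z := by
          have := sub_smul_dslope r 0 z
          rw [sub_zero] at this
          rw [this]
          abel
        exact (derivOne_eq_add_smul _ h5).symm
    exact isBigO_pow_succ_of_hasDerivAt (hlF.mono fun z hz => hz F (hol F hF))
      (by simp [hc0, hone F hF]) (key n le_rfl l hl)

/-- Join 1 to g by a segment in a chart ball: F along it is analytic and flat at 0, hence zero. `N`
is chosen before the family so that it also serves all left translates of a family. -/
theorem eventually_eq_zero_of_forall_derivOne_mem :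
    ∃ N ∈ 𝓝 (1 : G), ∀ 𝓕 : Set (G → ℂ), (∀ F ∈ 𝓕, IsHolomorphic X F) →
      (∀ F ∈ 𝓕, ∀ x : GroupLieAlgebra 𝓘(ℂ, X) G,
        (fun g => derivOne (X := X) (fun h => F (g * h)) x) ∈ 𝓕) →
      (∀ F ∈ 𝓕, F 1 = 0) → ∀ F ∈ 𝓕, ∀ g ∈ N, F g = 0 := by
  set φ := chartAt X (1 : G)
  set a := φ 1
  have h1s : (1 : G) ∈ φ.source := mem_chart_source X 1
  obtain ⟨R, hR, hball⟩ := Metric.isOpen_iff.1 φ.open_target a (mem_chart_target X 1)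
  refine ⟨φ.source ∩ φ ⁻¹' ball a R, inter_mem (φ.open_source.mem_nhds h1s)
    ((φ.continuousAt h1s) (ball_mem_nhds a hR)), fun 𝓕 hol hder hone F hF g hg => ?_⟩
  let c : ℂ → G := fun z => φ.symm (a + z • (φ g - a))
  let S : Set ℂ := (fun z : ℂ => a + z • (φ g - a)) ⁻¹' ball a R
  have hcont : Continuous fun z : ℂ => a + z • (φ g - a) := by fun_prop
  have hSo : IsOpen S := isOpen_ball.preimage hcont
  have hSc : Convex ℝ S := by
    intro z hz w hw s t hs ht hst
    have := convex_ball a R hz hw hs ht hst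
    simp only [S, Set.mem_preimage]
    convert this using 1
    rw [smul_add, smul_add, add_smul, smul_assoc, smul_assoc, add_add_add_comm, ← add_smul, hst,
      one_smul]
  have h0S : (0 : ℂ) ∈ S := by simpa [S] using hR
  have hc : ∀ z ∈ S, ContMDiffAt 𝓘(ℂ, ℂ) 𝓘(ℂ, X) ω c z := by
    intro z hz
    have h1 : ContMDiffAt 𝓘(ℂ, X) 𝓘(ℂ, X) ω φ.symm (a + z • (φ g - a)) :=
      contMDiffAt_symm_of_mem_maximalAtlas (IsManifold.chart_mem_maximalAtlas 1) (hball hz)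
    have h2 : ContDiff ℂ ω fun z : ℂ => a + z • (φ g - a) := by fun_prop
    exact ContMDiffAt.comp z h1 h2.contMDiff.contMDiffAt
  have hFc : AnalyticOnNhd ℂ (F ∘ c) S := by
    refine DifferentiableOn.analyticOnNhd (fun z hz => ?_) hSo
    exact ((hol F hF).hasFDerivAt_comp
      ((hc z hz).mdifferentiableAt (by simp))).differentiableAt.differentiableWithinAt
  have hc0 : c 0 = 1 := by simp [c, a, φ.left_inv h1s]
  have hev := eventually_eq_zero_of_forall_isBigO_pow (hFc 0 h0S) fun n =>
    isBigO_pow_of_forall_derivOne_mem hol hder hone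
      (Filter.eventually_of_mem (hSo.mem_nhds h0S) hc) hc0 n F hF
  have h1S : (1 : ℂ) ∈ S := by simpa [S] using hg.2
  have := hFc.eqOn_zero_of_preconnected_of_eventuallyEq_zero hSc.isPreconnected h0S hev h1S
  simpa [c, φ.left_inv hg.1] using this

/-- The identity theorem on a connected complex Lie group: if a family of holomorphic functions is
closed under right-derivatives and all its members vanish at `1`, then all of them are zero. -/
theorem eq_zero_of_forall_derivOne_mem [ConnectedSpace G] {𝓕 : Set (G → ℂ)}
    (hol : ∀ F ∈ 𝓕, IsHolomorphic X F)
    (hder : ∀ F ∈ 𝓕, ∀ x : GroupLieAlgebra 𝓘(ℂ, X) G,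
      (fun g => derivOne (X := X) (fun h => F (g * h)) x) ∈ 𝓕)
    (hone : ∀ F ∈ 𝓕, F 1 = 0) {F : G → ℂ} (hF : F ∈ 𝓕) (g : G) : F g = 0 := by
  have := topologicalGroup_of_lieGroup 𝓘(ℂ, X) ω (G := G)
  obtain ⟨N, hN, hzero⟩ := eventually_eq_zero_of_forall_derivOne_mem (X := X) (G := G)
  -- Translating the family by a common zero g preserves the hypotheses, so S · N ⊆ S. This makes S
  -- both open and closed.
  let S : Set G := {g | ∀ F ∈ 𝓕, F g = 0}
  have htrans : ∀ g ∈ S, ∀ h ∈ N, g * h ∈ S := by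
    intro g hg h hh F hF
    refine hzero {F' | ∃ F ∈ 𝓕, F' = fun h => F (g * h)} ?_ ?_ ?_ (fun h => F (g * h))
      ⟨F, hF, rfl⟩ h hh
    · rintro _ ⟨F, hF, rfl⟩
      exact (hol F hF).comp_mul_left g
    · rintro _ ⟨F, hF, rfl⟩ x
      refine ⟨_, hder F hF x, ?_⟩
      ext h
      simp only [mul_assoc]
    · rintro _ ⟨F, hF, rfl⟩
      simpa using hg F hF
  have hopen : IsOpen S := by
    refine isOpen_iff_mem_nhds.2 fun g hg => ?_
    have : (fun h => g⁻¹ * h) ⁻¹' N ∈ 𝓝 g :=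
      (continuous_const_mul g⁻¹).continuousAt (by simpa using hN)
    filter_upwards [this] with h hh
    simpa using htrans g hg _ hh
  have hclosed : IsClosed S := by
    refine ⟨isOpen_iff_mem_nhds.2 fun g hg => ?_⟩
    have : (fun h => h⁻¹ * g) ⁻¹' N ∈ 𝓝 g :=
      (continuous_inv.mul continuous_const).continuousAt (by simpa using hN)
    filter_upwards [this] with h hh hS
    exact hg (by simpa using htrans h hS _ hh)
  have hS : S = Set.univ := IsClopen.eq_univ ⟨hclosed, hopen⟩ ⟨1, hone⟩
  exact (hS ▸ Set.mem_univ g : g ∈ S) F hF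

end Identity

/-! ### Left-invariant vector fields in a chart and the Lie bracket. -/

section Bracket

variable {X : Type*} [NormedAddCommGroup X] [NormedSpace ℂ X] [CompleteSpace X]
  {G : Type*} [TopologicalSpace G] [ChartedSpace X G] [Group G] [LieGroup 𝓘(ℂ, X) ω G]

/-- The left-invariant vector field with value `x` at `1`, in the preferred chart at `1`. -/
def chartField (x : GroupLieAlgebra 𝓘(ℂ, X) G) : X → X :=
  VectorField.mpullbackWithin 𝓘(ℂ, X) 𝓘(ℂ, X) (extChartAt 𝓘(ℂ, X) (1 : G)).symm
    (mulInvariantVectorField x) (Set.range 𝓘(ℂ, X))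

theorem mulInvariantVectorField_one (x : GroupLieAlgebra 𝓘(ℂ, X) G) :
    (mulInvariantVectorField x (1 : G) : X) = x := by
  have h : (fun h : G => 1 * h) = id := by
    ext h
    simp
  -- Quantifying over `φ` allows substitution where the tangent space depends on the map.
  have h2 : ∀ φ : G → G, φ = id → (mfderiv 𝓘(ℂ, X) 𝓘(ℂ, X) φ 1 x : X) = x := by
    rintro _ rfl
    rw [mfderiv_id]
    rfl
  exact h2 _ h

theorem chartField_chartAt_one (x : GroupLieAlgebra 𝓘(ℂ, X) G) :
    chartField x (chartAt X (1 : G) 1) = x := by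
  have h1 := mfderivWithin_range_extChartAt_symm (I := 𝓘(ℂ, X)) (x := (1 : G))
  have h2 : ∀ g : G, g = 1 → (mulInvariantVectorField x g : X) = x := by
    rintro _ rfl
    exact mulInvariantVectorField_one x
  have h3 : (extChartAt 𝓘(ℂ, X) (1 : G)).symm (extChartAt 𝓘(ℂ, X) (1 : G) 1) = 1 :=
    extChartAt_to_inv 1
  change (mfderivWithin 𝓘(ℂ, X) 𝓘(ℂ, X) (extChartAt 𝓘(ℂ, X) (1 : G)).symm (Set.range 𝓘(ℂ, X))
    (extChartAt 𝓘(ℂ, X) (1 : G) 1)).inverse (mulInvariantVectorField x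
    ((extChartAt 𝓘(ℂ, X) (1 : G)).symm (extChartAt 𝓘(ℂ, X) (1 : G) 1))) = x
  refine Eq.trans ?_ (h2 _ h3)
  refine (DFunLike.congr_fun (congrArg ContinuousLinearMap.inverse h1) _).trans ?_
  exact DFunLike.congr_fun ContinuousLinearMap.inverse_id _

theorem differentiableAt_chartField (x : GroupLieAlgebra 𝓘(ℂ, X) G) :
    DifferentiableAt ℂ (chartField x) (chartAt X (1 : G) 1) := by
  have h1 := VectorField.contMDiffWithinAt_mpullbackWithin_extChartAt_symm
    (I := 𝓘(ℂ, X)) (n := ω) (m := 1) (s := Set.univ) (x := (1 : G))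
    (V := mulInvariantVectorField x)
    (((contMDiffAt_mulInvariantVectorField x).of_le (by norm_num)).contMDiffWithinAt)
    (uniqueMDiffOn_univ) (Set.mem_univ _) (by simp)
  have h2 := contMDiffWithinAt_vectorSpace_iff_contDiffWithinAt.1 h1
  refine (h2.differentiableWithinAt one_ne_zero).differentiableAt ?_
  simpa using (chartAt X (1 : G)).open_target.mem_nhds (mem_chart_target X 1)

theorem chartField_eq_fderiv (x : GroupLieAlgebra 𝓘(ℂ, X) G) {u : X}
    (hu : u ∈ (chartAt X (1 : G)).target) :
    chartField x u = fderiv ℂ (chartAt X (1 : G) ∘ (fun h => (chartAt X (1 : G)).symm u * h) ∘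
      (chartAt X (1 : G)).symm) (chartAt X (1 : G) 1) x := by
  set g := (chartAt X (1 : G)).symm u
  have hu' : u ∈ (extChartAt 𝓘(ℂ, X) (1 : G)).target := by simpa using hu
  have h1 : (mfderivWithin 𝓘(ℂ, X) 𝓘(ℂ, X) (extChartAt 𝓘(ℂ, X) (1 : G)).symm (Set.range 𝓘(ℂ, X))
      u).inverse = mfderiv 𝓘(ℂ, X) 𝓘(ℂ, X) (extChartAt 𝓘(ℂ, X) (1 : G)) g :=
    ContinuousLinearMap.inverse_eq
      (mfderivWithin_extChartAt_symm_comp_mfderiv_extChartAt hu')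
      (mfderiv_extChartAt_comp_mfderivWithin_extChartAt_symm hu')
  have hg : g ∈ (chartAt X (1 : G)).source := (chartAt X (1 : G)).map_target hu
  have h2 : MDifferentiableAt 𝓘(ℂ, X) 𝓘(ℂ, X) (extChartAt 𝓘(ℂ, X) (1 : G)) (g * 1) := by
    rw [mul_one]
    exact mdifferentiableAt_extChartAt hg
  have h3 := mfderiv_comp (1 : G) h2 (mdifferentiable_mul_left (X := X) g 1)
  have h4 : mfderiv 𝓘(ℂ, X) 𝓘(ℂ, X) (extChartAt 𝓘(ℂ, X) (1 : G) ∘ fun h => g * h) 1 =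
      fderiv ℂ (chartAt X (1 : G) ∘ (fun h => g * h) ∘ (chartAt X (1 : G)).symm)
        (chartAt X (1 : G) 1) := by
    have h5 : Set.range 𝓘(ℂ, X) = Set.univ := 𝓘(ℂ, X).range_eq_univ
    refine (h2.comp (1 : G) (mdifferentiable_mul_left (X := X) g 1)).mfderiv.trans ?_
    rw [h5, fderivWithin_univ]
    rfl
  have h6 : ∀ g' : G, g' = g → ∀ w : X,
      (mfderiv 𝓘(ℂ, X) 𝓘(ℂ, X) (extChartAt 𝓘(ℂ, X) (1 : G)) g' w : X) =
      mfderiv 𝓘(ℂ, X) 𝓘(ℂ, X) (extChartAt 𝓘(ℂ, X) (1 : G)) g w := by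
    rintro _ rfl w
    rfl
  refine (DFunLike.congr_fun h1 _).trans ?_
  refine Eq.trans ?_ (DFunLike.congr_fun (h3.symm.trans h4) x)
  exact (h6 _ (mul_one g) _).symm

theorem lie_eq_lieBracket_chartField (x y : GroupLieAlgebra 𝓘(ℂ, X) G) :
    (⁅x, y⁆ : GroupLieAlgebra 𝓘(ℂ, X) G) =
      VectorField.lieBracket ℂ (chartField x) (chartField y) (chartAt X (1 : G) 1) := by
  have h1 := mfderiv_extChartAt_self (I := 𝓘(ℂ, X)) (x := (1 : G))
  have h2 : (extChartAt 𝓘(ℂ, X) (1 : G)).symm ⁻¹' Set.univ ∩ Set.range 𝓘(ℂ, X) = Set.univ := by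
    rw [Set.preimage_univ, Set.univ_inter]
    exact 𝓘(ℂ, X).range_eq_univ
  rw [GroupLieAlgebra.bracket_def, ← VectorField.mlieBracketWithin_univ,
    VectorField.mlieBracketWithin_apply, h2]
  refine (DFunLike.congr_fun (congrArg ContinuousLinearMap.inverse h1) _).trans ?_
  refine (DFunLike.congr_fun ContinuousLinearMap.inverse_id _).trans ?_
  exact congrFun (VectorField.lieBracketWithin_univ (E := X) (V := chartField x)
    (W := chartField y)) _

/-- The bridge from vector fields to the group: differentiating F along the chart expression of a
left-invariant field is right-differentiation of F. -/
theorem fderiv_apply_chartField {F : G → ℂ} (hF : IsHolomorphic X F)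
    (x : GroupLieAlgebra 𝓘(ℂ, X) G) {u : X} (hu : u ∈ (chartAt X (1 : G)).target) :
    fderiv ℂ (F ∘ (chartAt X (1 : G)).symm) u (chartField x u) =
      derivOne (X := X) (fun h => F ((chartAt X (1 : G)).symm u * h)) x := by
  rw [chartField_eq_fderiv x hu]
  set φ := chartAt X (1 : G)
  set g := φ.symm u
  have h1 : φ.symm (φ 1) = 1 := φ.left_inv (mem_chart_source X 1)
  have hg : g ∈ φ.source := φ.map_target hu
  have hc : MDifferentiableAt 𝓘(ℂ, X) 𝓘(ℂ, X) ((fun h => g * h) ∘ φ.symm) (φ 1) :=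
    (mdifferentiable_mul_left (X := X) g _).comp _
      (mdifferentiableAt_chartAt_symm 1 (mem_chart_target X 1))
  have hgv : ((fun h => g * h) ∘ φ.symm) (φ 1) = g := by simp [h1]
  have hd : DifferentiableAt ℂ (φ ∘ (fun h => g * h) ∘ φ.symm) (φ 1) := by
    refine MDifferentiableAt.differentiableAt ?_
    refine MDifferentiableAt.comp (φ 1) (g := φ) (f := (fun h => g * h) ∘ φ.symm) ?_ hc
    rw [hgv]
    exact mdifferentiableAt_atlas (chart_mem_atlas X 1) hg
  have hv : (φ ∘ (fun h => g * h) ∘ φ.symm) (φ 1) = u := by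
    simp only [Function.comp_apply, h1, mul_one]
    exact φ.right_inv hu
  have h2 : HasFDerivAt (F ∘ φ.symm) (fderiv ℂ (F ∘ φ.symm) u)
      ((φ ∘ (fun h => g * h) ∘ φ.symm) (φ 1)) := by
    rw [hv]
    exact hF.hasFDerivAt 1 hu
  have h3 := h2.comp (φ 1) hd.hasFDerivAt
  have h4 : (fun h => F (g * h)) ∘ φ.symm =ᶠ[𝓝 (φ 1)]
      (F ∘ φ.symm) ∘ φ ∘ (fun h => g * h) ∘ φ.symm := by
    have : φ.source ∈ 𝓝 (((fun h => g * h) ∘ φ.symm) (φ 1)) := by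
      rw [hgv]
      exact φ.open_source.mem_nhds hg
    filter_upwards [hc.continuousAt this] with w hw
    exact congrArg F (φ.left_inv hw).symm
  exact (DFunLike.congr_fun (h3.congr_of_eventuallyEq h4).fderiv x).symm

/-- Right-derivatives of a holomorphic function on a Lie group satisfy the commutation relations of
the Lie algebra. -/
theorem derivOne_lie {F : G → ℂ} (hF : IsHolomorphic X F) (x y : GroupLieAlgebra 𝓘(ℂ, X) G)
    (hx : IsHolomorphic X fun g => derivOne (X := X) (fun h => F (g * h)) x)
    (hy : IsHolomorphic X fun g => derivOne (X := X) (fun h => F (g * h)) y) :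
    derivOne (X := X) F ⁅x, y⁆ =
      derivOne (X := X) (fun g => derivOne (X := X) (fun h => F (g * h)) y) x -
      derivOne (X := X) (fun g => derivOne (X := X) (fun h => F (g * h)) x) y := by
  -- Identifies the directional derivatives found in the chart with iterated right-derivatives at 1.
  have key : ∀ (z : X) (w : GroupLieAlgebra 𝓘(ℂ, X) G),
      IsHolomorphic X (fun g => derivOne (X := X) (fun h => F (g * h)) w) → ∀ d : ℂ,
      HasDerivAt (fun ζ : ℂ => fderiv ℂ (F ∘ (chartAt X (1 : G)).symm)
        (chartAt X (1 : G) 1 + ζ • z) (chartField w (chartAt X (1 : G) 1 + ζ • z))) d 0 →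
      d = derivOne (X := X) (fun g => derivOne (X := X) (fun h => F (g * h)) w) z := by
    intro z w hw d hd
    have h1 := hasFDerivAt_of_isHolomorphic hw
    have h0 : chartAt X (1 : G) 1 + (0 : ℂ) • z = chartAt X (1 : G) 1 := by simp
    rw [← h0] at h1
    have h2 := h1.comp_hasDerivAt (0 : ℂ) (hasDerivAt_line (chartAt X (1 : G) 1) z 0)
    rw [h0] at h2
    refine hd.unique (h2.congr_of_eventuallyEq ?_)
    obtain ⟨δ, hδ, hδz⟩ := eventually_line_mem
      ((chartAt X (1 : G)).open_target.mem_nhds (mem_chart_target X 1)) z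
    filter_upwards [Metric.ball_mem_nhds (0 : ℂ) hδ] with ζ hζ
    exact fderiv_apply_chartField hF w (hδz ζ hζ)
  obtain ⟨d, e, hd, he, hde⟩ := exists_hasDerivAt_sub_eq_lieBracket
    (chartAt X (1 : G)).open_target (hF 1) (mem_chart_target X 1)
    (differentiableAt_chartField x) (differentiableAt_chartField y)
  rw [chartField_chartAt_one] at hd he
  rw [← key x y hy d hd, ← key y x hx e he, hde, lie_eq_lieBracket_chartField]
  rfl

end Bracket

/-- Hahn–Banach separation, which reduces identities between vectors to scalar holomorphic
functions. -/
theorem eq_of_forall_continuousLinearMap {E : Type*} [AddCommGroup E] [Module ℂ E]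
    [TopologicalSpace E] [IsTopologicalAddGroup E] [ContinuousSMul ℂ E] [LocallyConvexSpace ℝ E]
    [T2Space E] {x y : E} (h : ∀ l : E →L[ℂ] ℂ, l x = l y) : x = y := by
  by_contra hxy
  obtain ⟨f, hf⟩ := RCLike.geometric_hahn_banach_point_point (𝕜 := ℂ) hxy
  exact absurd hf (by rw [h f]; exact lt_irrefl _)

/-- Induction principle for the universal enveloping algebra, along left multiplication by elements
of the Lie algebra. -/
theorem universalEnvelopingAlgebra_induction {L : Type*} [LieRing L] [LieAlgebra ℂ L]
    (S : Submodule ℂ (UniversalEnvelopingAlgebra ℂ L)) (h1 : 1 ∈ S)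
    (hS : ∀ (x : L), ∀ D ∈ S, UniversalEnvelopingAlgebra.ι ℂ x * D ∈ S)
    (D : UniversalEnvelopingAlgebra ℂ L) : D ∈ S := by
  obtain ⟨t, rfl⟩ : ∃ t, UniversalEnvelopingAlgebra.mkAlgHom ℂ L t = D := Quotient.exists_rep D
  -- The strengthened claim, that left multiplication by t preserves S, is multiplicative in t.
  suffices h : ∀ D ∈ S, UniversalEnvelopingAlgebra.mkAlgHom ℂ L t * D ∈ S by
    simpa using h 1 h1
  induction t using TensorAlgebra.induction with
  | algebraMap r =>
    intro D hD
    rw [AlgHom.commutes, ← Algebra.smul_def]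
    exact S.smul_mem r hD
  | ι x => exact hS x
  | mul a b ha hb =>
    intro D hD
    rw [map_mul, mul_assoc]
    exact ha _ (hb D hD)
  | add a b ha hb =>
    intro D hD
    rw [map_add, add_mul]
    exact S.add_mem (ha D hD) (hb D hD)

/-! ### The derived representation and the action of U(𝔤). -/

section Derived

variable {X : Type*} [NormedAddCommGroup X] [NormedSpace ℂ X]
  {G : Type*} [TopologicalSpace G] [ChartedSpace X G] [Group G]
  {V : Type*} [AddCommGroup V] [Module ℂ V] [TopologicalSpace V] [IsTopologicalAddGroup V]
  [ContinuousSMul ℂ V] [T2Space V]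
  {F : Type*} [AddCommGroup F] [Module ℂ F] [TopologicalSpace F] [IsTopologicalAddGroup F]
  [ContinuousSMul ℂ F] [T2Space F]
  (π : G →* (V →L[ℂ] V)) (hπ : HasHolomorphicOrbits X π)

include hπ in
theorem isHolomorphic_orbit (L : V →L[ℂ] F) (v : V) : IsHolomorphic X (fun g => L (π g v)) :=
  (hπ v).clm_comp L

/-- Since π(gh) = π(g)π(h), coefficient functions are closed under right-derivatives; this supplies
the families for the identity theorem. -/
theorem derivOne_orbit_mul_left (L : V →L[ℂ] F) (v : V) (x : GroupLieAlgebra 𝓘(ℂ, X) G) (g : G) :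
    derivOne (X := X) (fun h => L (π (g * h) v)) x = L (π g (derivedRep π hπ x v)) := by
  rw [show (fun h => L (π (g * h) v)) = (L.comp (π g)) ∘ fun h => π h v by
    ext h
    simp]
  exact derivOne_clm_comp (L.comp (π g)) (hπ v) x

theorem derivOne_orbit (L : V →L[ℂ] F) (v : V) (x : GroupLieAlgebra 𝓘(ℂ, X) G) :
    derivOne (X := X) (fun h => L (π h v)) x = L (derivedRep π hπ x v) :=
  derivOne_clm_comp L (hπ v) x

variable [CompleteSpace X] [LieGroup 𝓘(ℂ, X) ω G]

theorem derivedRep_lie [LocallyConvexSpace ℝ V] (x y : GroupLieAlgebra 𝓘(ℂ, X) G) (v : V) :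
    derivedRep π hπ ⁅x, y⁆ v =
      derivedRep π hπ x (derivedRep π hπ y v) - derivedRep π hπ y (derivedRep π hπ x v) := by
  refine eq_of_forall_continuousLinearMap fun l => ?_
  have h := derivOne_lie (isHolomorphic_orbit π hπ l v) x y
  simp only [derivOne_orbit_mul_left π hπ l, derivOne_orbit π hπ l] at h
  rw [h (isHolomorphic_orbit π hπ l _) (isHolomorphic_orbit π hπ l _), map_sub]

attribute [local instance] LieRing.ofAssociativeRing

/-- The antihomomorphism from `U(𝔤)` to the endomorphisms of `V` that sends `x` in `𝔤` to the
operator `- x`, for the derived action: the derived action after the principal antiautomorphism. -/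
def derivedRepAnti [LocallyConvexSpace ℝ V] :
    UniversalEnvelopingAlgebra ℂ (GroupLieAlgebra 𝓘(ℂ, X) G) →ₐ[ℂ] (Module.End ℂ V)ᵐᵒᵖ :=
  UniversalEnvelopingAlgebra.lift ℂ
    { toFun := fun x => - MulOpposite.op (derivedRep π hπ x)
      map_add' := fun x y => by
        have : derivedRep π hπ (x + y) = derivedRep π hπ x + derivedRep π hπ y := by
          ext v
          exact derivOne_vadd _ x y
        rw [this, MulOpposite.op_add, neg_add]
      map_smul' := fun c x => by
        have : derivedRep π hπ (c • x) = c • derivedRep π hπ x := by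
          ext v
          exact derivOne_vsmul _ c x
        rw [this, MulOpposite.op_smul, smul_neg, RingHom.id_apply]
      map_lie' := fun {x y} => by
        refine MulOpposite.unop_injective (LinearMap.ext fun v => ?_)
        simp only [LieRing.of_associative_ring_bracket, MulOpposite.unop_neg, MulOpposite.unop_op,
          MulOpposite.unop_sub, MulOpposite.unop_mul, neg_mul_neg, LinearMap.neg_apply,
          LinearMap.sub_apply, Module.End.mul_apply, derivedRep_lie, neg_sub] }

theorem derivedRepAnti_mul_apply [LocallyConvexSpace ℝ V]
    (D D' : UniversalEnvelopingAlgebra ℂ (GroupLieAlgebra 𝓘(ℂ, X) G)) (v : V) :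
    (derivedRepAnti π hπ (D * D')).unop v =
      (derivedRepAnti π hπ D').unop ((derivedRepAnti π hπ D).unop v) := by
  rw [map_mul, MulOpposite.unop_mul, Module.End.mul_apply]

theorem derivedRepAnti_ι_apply [LocallyConvexSpace ℝ V] (x : GroupLieAlgebra 𝓘(ℂ, X) G) (v : V) :
    (derivedRepAnti π hπ (UniversalEnvelopingAlgebra.ι ℂ x)).unop v = - derivedRep π hπ x v := by
  rw [derivedRepAnti, UniversalEnvelopingAlgebra.lift_ι_apply]
  rfl

theorem forall_apply_eq_zero_of_derivedRepAnti [ConnectedSpace G] [LocallyConvexSpace ℝ V]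
    [LocallyConvexSpace ℝ F] (β : V →L[ℂ] F) {v : V}
    (h : ∀ D, β ((derivedRepAnti π hπ D).unop v) = 0) (g : G) : β (π g v) = 0 := by
  refine eq_of_forall_continuousLinearMap fun l => ?_
  rw [map_zero]
  refine eq_zero_of_forall_derivOne_mem (X := X) (F := fun g => l (β (π g v)))
    (𝓕 := {f | ∃ D, f = fun g => l (β (π g ((derivedRepAnti π hπ D).unop v)))}) ?_ ?_ ?_
    ⟨1, by simp⟩ g
  · rintro _ ⟨D, rfl⟩
    exact isHolomorphic_orbit π hπ (l.comp β) _
  · rintro _ ⟨D, rfl⟩ x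
    -- In the opposite algebra D * x applies D first and then -x, hence the order and the sign.
    refine ⟨- (D * UniversalEnvelopingAlgebra.ι ℂ x), ?_⟩
    ext g
    refine (derivOne_orbit_mul_left π hπ (l.comp β) _ x g).trans ?_
    rw [map_neg, MulOpposite.unop_neg, LinearMap.neg_apply, derivedRepAnti_mul_apply,
      derivedRepAnti_ι_apply, neg_neg]
    rfl
  · rintro _ ⟨D, rfl⟩
    simp [h D]

end Derived

/-! ### Equivariance under P versus equivariance under 𝔭. -/

section Intertwining

variable {X : Type*} [NormedAddCommGroup X] [NormedSpace ℂ X]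
  {G : Type*} [TopologicalSpace G] [ChartedSpace X G] [Group G]
  {Y : Type*} [NormedAddCommGroup Y] [NormedSpace ℂ Y]
  {P : Type*} [TopologicalSpace P] [ChartedSpace Y P] [Group P] [LieGroup 𝓘(ℂ, Y) ω P]
  {V : Type*} [AddCommGroup V] [Module ℂ V] [TopologicalSpace V] [IsTopologicalAddGroup V]
  [ContinuousSMul ℂ V] [T2Space V]
  {E : Type*} [AddCommGroup E] [Module ℂ E] [TopologicalSpace E] [IsTopologicalAddGroup E]
  [ContinuousSMul ℂ E] [T2Space E]
  (π : G →* (V →L[ℂ] V)) (hπ : HasHolomorphicOrbits X π)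
  (ρ : P →* (E →L[ℂ] E)) (hρ : HasHolomorphicOrbits Y ρ)
  (incl : P →* G) (hincl : MDifferentiable 𝓘(ℂ, Y) 𝓘(ℂ, X) incl)

include hincl in
theorem hasHolomorphicOrbits_comp (hπ : HasHolomorphicOrbits X π) :
    HasHolomorphicOrbits Y (π.comp incl) := fun v => (hπ v).comp hincl

include hincl in
theorem derivedRep_comp_apply (y : GroupLieAlgebra 𝓘(ℂ, Y) P) (v : V) :
    derivedRep (π.comp incl) (hasHolomorphicOrbits_comp π incl hincl hπ) y v =
      derivedRep π hπ (lieMap (X := X) incl y) v :=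
  derivOne_comp_hom (hπ v) incl hincl y

include hincl in
theorem apply_derivedRep_lieMap {β : V →L[ℂ] E}
    (hβ : ∀ (p : P) (v : V), β (π (incl p) v) = ρ p (β v)) (y : GroupLieAlgebra 𝓘(ℂ, Y) P) (v : V) :
    β (derivedRep π hπ (lieMap (X := X) incl y) v) = derivedRep ρ hρ y (β v) := by
  rw [← derivedRep_comp_apply π hπ incl hincl, ← derivOne_orbit]
  congr 1
  ext p
  exact hβ p v

/-- A continuous linear map that intertwines the derived actions of the Lie algebra of a connected
Lie group `P` intertwines the actions of `P`. -/
theorem apply_eq_of_apply_derivedRep [CompleteSpace Y] [ConnectedSpace P]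
    [LocallyConvexSpace ℝ E] {σ : P →* (V →L[ℂ] V)} (hσ : HasHolomorphicOrbits Y σ) {β : V →L[ℂ] E}
    (hβ : ∀ (y : GroupLieAlgebra 𝓘(ℂ, Y) P) (v : V),
      β (derivedRep σ hσ y v) = derivedRep ρ hρ y (β v)) (p : P) (v : V) :
    β (σ p v) = ρ p (β v) := by
  refine eq_of_forall_continuousLinearMap fun l => sub_eq_zero.1 ?_
  have h1 : ∀ w, IsHolomorphic Y (fun p => l (β (σ p w))) := fun w =>
    isHolomorphic_orbit σ hσ (l.comp β) w
  have h2 : ∀ w, IsHolomorphic Y (fun p => l (ρ p w)) := fun w => isHolomorphic_orbit ρ hρ l w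
  have h3 : ∀ w, (fun p => l (β (σ p w)) - l (ρ p (β w))) =
      (fun p => l (β (σ p w))) + (-1 : ℂ) • fun p => l (ρ p (β w)) := fun w => by
    ext p
    simp [sub_eq_add_neg]
  -- The defects of equivariance for all w form the family: as β intertwines the derived actions,
  -- right-differentiation along y replaces w by y.w.
  refine eq_zero_of_forall_derivOne_mem (X := Y)
    (𝓕 := {f | ∃ w, f = fun p => l (β (σ p w)) - l (ρ p (β w))}) ?_ ?_ ?_ ⟨v, rfl⟩ p
  · rintro _ ⟨w, rfl⟩
    rw [h3]
    exact (h1 w).add ((h2 _).smul _)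
  · rintro _ ⟨w, rfl⟩ y
    refine ⟨derivedRep σ hσ y w, ?_⟩
    ext p
    have h4 : (fun q => l (β (σ (p * q) w)) - l (ρ (p * q) (β w))) =
        (fun q => l (β (σ (p * q) w))) + (-1 : ℂ) • fun q => l (ρ (p * q) (β w)) := by
      ext q
      simp [sub_eq_add_neg]
    rw [h4, derivOne_add ((h1 w).comp_mul_left p) (((h2 _).comp_mul_left p).smul _),
      derivOne_smul _ ((h2 _).comp_mul_left p), derivOne_orbit_mul_left ρ hρ l, hβ]
    have h5 := derivOne_orbit_mul_left σ hσ (l.comp β) w y p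
    simp only [ContinuousLinearMap.comp_apply] at h5
    rw [h5]
    simp [sub_eq_add_neg]
  · rintro _ ⟨w, rfl⟩
    simp

end Intertwining

/-! ### The two reciprocity maps and the equivalence. -/

section Equivalences

variable {X : Type*} [NormedAddCommGroup X] [NormedSpace ℂ X] [CompleteSpace X]
  {G : Type*} [TopologicalSpace G] [ChartedSpace X G] [Group G] [LieGroup 𝓘(ℂ, X) ω G]
  {Y : Type*} [NormedAddCommGroup Y] [NormedSpace ℂ Y] [CompleteSpace Y]
  {P : Type*} [TopologicalSpace P] [ChartedSpace Y P] [Group P] [LieGroup 𝓘(ℂ, Y) ω P]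
  {V : Type*} [AddCommGroup V] [Module ℂ V] [TopologicalSpace V] [IsTopologicalAddGroup V]
  [ContinuousSMul ℂ V] [T2Space V]
  {E : Type*} [AddCommGroup E] [Module ℂ E] [TopologicalSpace E] [IsTopologicalAddGroup E]
  [ContinuousSMul ℂ E] [T2Space E]
  (π : G →* (V →L[ℂ] V)) (hπ : HasHolomorphicOrbits X π)
  (ρ : P →* (E →L[ℂ] E)) (hρ : HasHolomorphicOrbits Y ρ) (incl : P →* G)

/-- The `G`-morphism `V → O_ρ(G, E)` that corresponds to a `P`-morphism `β : V → E`. -/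
def toInducedSpace (β : V →L[ℂ] E) (hβ : ∀ (p : P) (v : V), β (π (incl p) v) = ρ p (β v)) :
    V →ₗ[ℂ] inducedSpace X incl ρ where
  toFun v := ⟨fun h => β (π h⁻¹ v),
    (isHolomorphic_orbit π hπ β v).comp
      ((contMDiff_inv 𝓘(ℂ, X) ω).mdifferentiable (by simp)), fun g p => by
        change β (π (g * incl p)⁻¹ v) = ρ p⁻¹ (β (π g⁻¹ v))
        rw [← hβ, map_inv incl, mul_inv_rev, map_mul]
        rfl⟩
  map_add' v w := by
    ext h
    simp
  map_smul' c v := by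
    ext h
    simp

/-- The `𝔤`-morphism `V → Hom_𝔭(U(𝔤), E)` that corresponds to a `𝔭`-morphism `β : V → E`. -/
def toCoinducedSpace [LocallyConvexSpace ℝ V] (β : V →L[ℂ] E)
    (hβ : ∀ (y : GroupLieAlgebra 𝓘(ℂ, Y) P) (v : V),
      β (derivedRep π hπ (lieMap (X := X) incl y) v) = derivedRep ρ hρ y (β v)) :
    V →ₗ[ℂ] coinducedSpace (X := X) incl ρ hρ where
  toFun v :=
    ⟨{ toFun := fun D => β ((derivedRepAnti π hπ D).unop v)
       map_add' := fun D D' => by simp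
       map_smul' := fun c D => by simp }, fun D y => by
        change β ((derivedRepAnti π hπ (D * _)).unop v) = - derivedRep ρ hρ y (β _)
        rw [derivedRepAnti_mul_apply, derivedRepAnti_ι_apply, map_neg, hβ]⟩
  map_add' v w := by
    ext D
    simp
  map_smul' c v := by
    ext D
    simp

/-- The vectors whose G-orbit lies in ker β form a 𝔤-stable set Z. The D killed by J(w) for every w
in Z therefore form a subspace stable under left multiplication by 𝔤; it contains 1, so it is all of
U(𝔤). -/
theorem eq_zero_of_forall_apply_one {J : V →ₗ[ℂ] coinducedSpace (X := X) incl ρ hρ}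
    (hJ : ∀ (x : GroupLieAlgebra 𝓘(ℂ, X) G) (v : V)
      (D : UniversalEnvelopingAlgebra ℂ (GroupLieAlgebra 𝓘(ℂ, X) G)),
      (J (derivedRep π hπ x v)).1 D = - (J v).1 (UniversalEnvelopingAlgebra.ι ℂ x * D))
    {β : V →L[ℂ] E} (hβ : ∀ v, β v = (J v).1 1) {v : V} (hv : ∀ g : G, β (π g v) = 0) :
    J v = 0 := by
  let Z : Set V := {v | ∀ g : G, β (π g v) = 0}
  have hZ : ∀ (x : GroupLieAlgebra 𝓘(ℂ, X) G), ∀ w ∈ Z, derivedRep π hπ x w ∈ Z := by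
    intro x w hw g
    rw [← derivOne_orbit_mul_left π hπ β w x g]
    have : (fun h => β (π (g * h) w)) = (0 : ℂ) • fun h => β (π (g * h) w) := by
      ext h
      exact (hw (g * h)).trans (zero_smul ℂ _).symm
    rw [this, derivOne_smul _ ((isHolomorphic_orbit π hπ β w).comp_mul_left g), zero_smul]
  -- All of Z is needed, not only v, because the induction step replaces w by x.w.
  let S : Submodule ℂ (UniversalEnvelopingAlgebra ℂ (GroupLieAlgebra 𝓘(ℂ, X) G)) :=
    ⨅ w : Z, LinearMap.ker (J w).1
  have hS : ∀ D, D ∈ S ↔ ∀ w ∈ Z, (J w).1 D = 0 := fun D => by simp [S, Submodule.mem_iInf]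
  ext D
  refine (hS D).1 (universalEnvelopingAlgebra_induction S ?_ ?_ D) v hv
  · refine (hS 1).2 fun w hw => ?_
    simpa [hβ] using hw 1
  · intro x D hD
    refine (hS _).2 fun w hw => ?_
    rw [← neg_eq_zero, ← hJ]
    exact (hS D).1 hD _ (hZ x w hw)

end Equivalences

end HolInd

end

theorem mainTheorem11
    -- `G`: a connected complex Banach-Lie group
    {X : Type*} [NormedAddCommGroup X] [NormedSpace ℂ X] [CompleteSpace X]
    {G : Type*} [TopologicalSpace G] [ChartedSpace X G] [Group G] [LieGroup 𝓘(ℂ, X) ω G]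
    [ConnectedSpace G]
    -- `P`: a connected complex Lie subgroup of `G`, with inclusion `incl`
    {Y : Type*} [NormedAddCommGroup Y] [NormedSpace ℂ Y] [CompleteSpace Y]
    {P : Type*} [TopologicalSpace P] [ChartedSpace Y P] [Group P] [LieGroup 𝓘(ℂ, Y) ω P]
    [ConnectedSpace P]
    (incl : P →* G) (incl_injective : Function.Injective incl)
    (incl_holomorphic : ContMDiff 𝓘(ℂ, Y) 𝓘(ℂ, X) ω incl)
    -- `V` and `E`: complex locally convex Hausdorff spaces
    {V : Type*} [AddCommGroup V] [Module ℂ V] [TopologicalSpace V] [IsTopologicalAddGroup V]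
    [ContinuousSMul ℂ V] [LocallyConvexSpace ℝ V] [T2Space V]
    {E : Type*} [AddCommGroup E] [Module ℂ E] [TopologicalSpace E] [IsTopologicalAddGroup E]
    [ContinuousSMul ℂ E] [LocallyConvexSpace ℝ E] [T2Space E]
    (π : G →* (V →L[ℂ] V)) (hπ : HolInd.HasHolomorphicOrbits X π)
    (ρ : P →* (E →L[ℂ] E)) (hρ : HolInd.HasHolomorphicOrbits Y ρ) :
    List.TFAE [
      -- (1) a `G`-cyclic continuous morphism of `P`-representations `V → E`
      ∃ β : V →L[ℂ] E, (∀ (p : P) (v : V), β (π (incl p) v) = ρ p (β v)) ∧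
        ∀ v : V, (∀ g : G, β (π g v) = 0) → v = 0,
      -- (2) a `G`-equivariant injection `V → O_ρ(G, E)`, continuous for pointwise convergence
      ∃ B : V →ₗ[ℂ] HolInd.inducedSpace X incl ρ, Function.Injective B ∧
        (∀ (g : G) (v : V) (h : G), (B (π g v) : G → E) h = (B v : G → E) (g⁻¹ * h)) ∧
        Continuous (fun v : V => (B v : G → E)),
      -- (3) a `𝔤`-equivariant injection `V → Hom_𝔭(U(𝔤), E)` with `ev_1` continuous on `V`
      ∃ J : V →ₗ[ℂ] HolInd.coinducedSpace (X := X) incl ρ hρ, Function.Injective J ∧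
        (∀ (x : GroupLieAlgebra 𝓘(ℂ, X) G) (v : V)
          (D : UniversalEnvelopingAlgebra ℂ (GroupLieAlgebra 𝓘(ℂ, X) G)),
          (J (HolInd.derivedRep π hπ x v)).1 D =
            - (J v).1 (UniversalEnvelopingAlgebra.ι ℂ x * D)) ∧
        Continuous (fun v : V => (J v).1 1)] := by
  have incl_mdifferentiable : MDifferentiable 𝓘(ℂ, Y) 𝓘(ℂ, X) incl :=
    incl_holomorphic.mdifferentiable (by simp)
  tfae_have 1 → 2 := by
    rintro ⟨β, hβ, hcyc⟩
    refine ⟨HolInd.toInducedSpace π hπ ρ incl β hβ,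
      (injective_iff_map_eq_zero _).2 fun v hv => hcyc v fun g => ?_, fun g v h => ?_,
      continuous_pi fun h => (β.comp (π h⁻¹)).continuous⟩
    · have := congrFun (congrArg Subtype.val hv) g⁻¹
      change β (π g⁻¹⁻¹ v) = 0 at this
      rwa [inv_inv] at this
    · change β (π h⁻¹ (π g v)) = β (π (g⁻¹ * h)⁻¹ v)
      rw [mul_inv_rev, inv_inv, map_mul]
      rfl
  tfae_have 2 → 1 := by
    rintro ⟨B, hinj, hequiv, hcont⟩
    -- β is evaluation at 1 after `B`.
    refine ⟨⟨(LinearMap.proj (1 : G)).comp ((Submodule.subtype _).comp B),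
      (continuous_apply (1 : G)).comp hcont⟩, fun p v => ?_, fun v hv => ?_⟩
    · change (B (π (incl p) v) : G → E) 1 = ρ p ((B v : G → E) 1)
      -- The covariance of B(v) at g = 1 and p⁻¹ gives ρ(p) without an inverse.
      have := (B v).2.2 1 p⁻¹
      rw [one_mul, map_inv, inv_inv] at this
      rw [hequiv, mul_one, this]
    · refine (injective_iff_map_eq_zero _).1 hinj v (Subtype.ext (funext fun h => ?_))
      have := (hequiv h⁻¹ v 1).symm.trans (hv h⁻¹)
      rwa [inv_inv, mul_one] at this
  tfae_have 1 → 3 := by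
    rintro ⟨β, hβ, hcyc⟩
    refine ⟨HolInd.toCoinducedSpace π hπ ρ hρ incl β
      (HolInd.apply_derivedRep_lieMap π hπ ρ hρ incl incl_mdifferentiable hβ),
      (injective_iff_map_eq_zero _).2 fun v hv => hcyc v ?_, fun x v D => ?_, ?_⟩
    · exact HolInd.forall_apply_eq_zero_of_derivedRepAnti π hπ β fun D =>
        LinearMap.congr_fun (congrArg Subtype.val hv) D
    · change β ((HolInd.derivedRepAnti π hπ D).unop (HolInd.derivedRep π hπ x v)) =
        - β ((HolInd.derivedRepAnti π hπ (UniversalEnvelopingAlgebra.ι ℂ x * D)).unop v)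
      rw [HolInd.derivedRepAnti_mul_apply, HolInd.derivedRepAnti_ι_apply, map_neg, map_neg, neg_neg]
    · change Continuous fun v => β ((HolInd.derivedRepAnti π hπ 1).unop v)
      simpa using β.continuous
  tfae_have 3 → 1 := by
    rintro ⟨J, hinj, hequiv, hcont⟩
    let β : V →L[ℂ] E := ⟨(LinearMap.applyₗ
      (1 : UniversalEnvelopingAlgebra ℂ (GroupLieAlgebra 𝓘(ℂ, X) G))).comp
        ((Submodule.subtype _).comp J), hcont⟩
    have hβ : ∀ v, β v = (J v).1 1 := fun v => rfl
    refine ⟨β, HolInd.apply_eq_of_apply_derivedRep ρ hρ (σ := π.comp incl)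
      (HolInd.hasHolomorphicOrbits_comp π incl incl_mdifferentiable hπ) fun y v => ?_,
      fun v hv => ?_⟩
    · rw [HolInd.derivedRep_comp_apply π hπ incl incl_mdifferentiable, hβ, hβ, hequiv, mul_one]
      -- With D = 1, the sign of the coinduced condition cancels that of the 𝔤-action.
      have := (J v).2 1 y
      rw [one_mul] at this
      rw [this, neg_neg]
    · exact (injective_iff_map_eq_zero _).1 hinj v
        (HolInd.eq_zero_of_forall_apply_one π hπ ρ hρ incl hequiv hβ hv)
  tfae_finish
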